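/- Fix a density $\rho\in(0,1)$ and consider integers $N\ge1$ and $p=\rho N$ (those $N$ for which $\rho N$ is an integer). Arguments and logarithms are principal, $\arg z\in(-\pi,\pi]$. Put $r_{\mathrm{cr}}=2^{1/\rho}\rho(1-\rho)^{1/\rho-1}$. For $C\in\mathbb C$ and $j=1,\dots,N$ define $u_j(C)$ as follows. Let $F(u)=\frac p\pi\arg(u-1)+\frac{N-p}\pi\arg(u+1)$ and let $I_j\subset(-N,N]$ be the image of $(-p+2(j-1),-p+2j]$ under reduction modulo $2N$. If $C\notin\mathbb R_{\ge0}$, $u_j(C)$ is the unique solution of $(1-u)^p(1+u)^{N-p}=C$ with $F(u)\in I_j$; if $C>0$, $u_j(C)=\lim_{\delta\uparrow0}u_j(Ce^{i\delta})$; and $u_j(0)=1$ for $j\le p$, $u_j(0)=-1$ for $j>p$. Put $$G_N(C)=\frac1p\sum_{j=1}^p\log(1+u_j(C))-\log2,\qquad \Lambda_N(C)=\frac12\sum_{j=1}^p(u_j(C)-1).$$ For $r>r_{\mathrm{cr}}$ let $u_*(r)$ be the unique $u$ with $\Im u>0$, $(1-u)^\rho(1+u)^{1-\rho}=r^\rho$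 and $\rho\arg(1-u)+(1-\rho)\arg(1+u)=0$, and put $$G_\infty(z)=\frac1\pi\Big\{\frac{1-\rho}\rho\log|1+z|\arg(1+z)+\log2\,\arg(1-z)-\Im\operatorname{Li}_2\Big(\frac12-\frac z2\Big)\Big\},\qquad \Lambda_\infty(z)=\frac1\pi\Big\{\frac{\Im z}2+(\rho-1)\arg(1+z)\Big\},$$ where $\operatorname{Li}_2(z)=-\int_0^z\frac{\log(1-u)}u\,du$ for $z\in\mathbb C\setminus[1,\infty)$. Then for every compact set $K\subset\mathbb R$ there is a constant $B=B(\rho,K)$ such that for all such $N,p$ and all real $C\le r_{\mathrm{cr}}^p$, with $r=|C|^{1/p}$, for which $C\in K$ or $r\in K$, $$\big|G_N(C)-\mathbf 1_{\{r>r_{\mathrm{cr}}\}}G_\infty(u_*(r))\big|\le\frac BN,\qquad \big|\Lambda_N(C)-N\,\mathbf 1_{\{r>r_{\mathrm{cr}}\}}\Lambda_\infty(u_*(r))\big|\le B.$$ -/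

import Mathlib

open Filter Topology

noncomputable section

namespace TASEP

/-- The critical focal radius `r_cr = 2^(1/ρ) ρ (1-ρ)^(1/ρ-1)`. -/
def rCrit (ρ : ℝ) : ℝ :=
  (2 : ℝ) ^ (1 / ρ) * ρ * (1 - ρ) ^ (1 / ρ - 1)

/-- `u` solves the decoupled Bethe equation `(1-u)^p (1+u)^(N-p) = C`. -/
def IsBetheRoot (N p : ℕ) (C u : ℂ) : Prop :=
  (1 - u) ^ p * (1 + u) ^ (N - p) = C

/-- The labelling function `F(u) = (p/π) arg(u-1) + ((N-p)/π) arg(u+1)`, principal arguments. -/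
def labelFun (N p : ℕ) (u : ℂ) : ℝ :=
  (p : ℝ) / Real.pi * (u - 1).arg + ((N : ℝ) - p) / Real.pi * (u + 1).arg

/-- The interval `I_j`: the image of `(-p+2(j-1), -p+2j]` under reduction modulo `2N` to the
representatives in `(-N, N]`. -/
def labelInterval (N p j : ℕ) : Set ℝ :=
  {x | x ∈ Set.Ioc (-(N : ℝ)) N ∧
    ∃ k : ℤ, x + 2 * (N : ℝ) * k ∈ Set.Ioc (-(p : ℝ) + 2 * ((j : ℝ) - 1)) (-(p : ℝ) + 2 * j)}

/-- The solution `u` of the Bethe equation with `F(u) ∈ I_j`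
(it is unique when `C` is not a nonnegative real). -/
def slitRoot (N p j : ℕ) (C : ℂ) : ℂ :=
  Classical.epsilon fun u : ℂ => IsBetheRoot N p C u ∧ labelFun N p u ∈ labelInterval N p j

/-- The solution map `u_j(C)`, `1 ≤ j ≤ N`: the root labelled by `I_j` if `C` is not a nonnegative
real, the limit from `Im C < 0` if `C > 0`, and, for `C = 0`, the root `1` for the first `p`
labels and `-1` for the others. -/
def betheRoot (N p j : ℕ) (C : ℂ) : ℂ :=
  if C = 0 then (if j ≤ p then 1 else -1)
  else if C.im = 0 ∧ 0 < C.re then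
    limUnder (𝓝[<] (0 : ℝ)) fun δ : ℝ => slitRoot N p j (C * Complex.exp (δ * Complex.I))
  else slitRoot N p j C

/-- `G_N(C) = (1/p) ∑_{j=1}^p log(1+u_j(C)) - log 2`. -/
def GN (N p : ℕ) (C : ℂ) : ℂ :=
  1 / (p : ℂ) * ∑ j ∈ Finset.Icc 1 p, Complex.log (1 + betheRoot N p j C) - Complex.log 2

/-- `Λ_N(C) = (1/2) ∑_{j=1}^p (u_j(C)-1)`. -/
def LambdaN (N p : ℕ) (C : ℂ) : ℂ :=
  1 / 2 * ∑ j ∈ Finset.Icc 1 p, (betheRoot N p j C - 1)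

/-- The dilogarithm `Li₂(z) = -∫_0^z log(1-u)/u du` for `z ∉ [1, ∞)`, the integral being taken
along the segment `u = t z`, `0 ≤ t ≤ 1`. -/
def dilog (z : ℂ) : ℂ :=
  -∫ t in (0 : ℝ)..1, Complex.log (1 - t * z) / t

/-- The function `G_∞`. -/
def GInf (ρ : ℝ) (z : ℂ) : ℝ :=
  1 / Real.pi * ((1 - ρ) / ρ * Real.log ‖1 + z‖ * (1 + z).arg
    + Real.log 2 * (1 - z).arg - (dilog (1 / 2 - z / 2)).im)

/-- The function `Λ_∞`. -/
def LambdaInf (ρ : ℝ) (z : ℂ) : ℝ :=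
  1 / Real.pi * (z.im / 2 + (ρ - 1) * (1 + z).arg)

/-- The system that characterizes `u_*(r)` for `r > r_cr`. -/
def IsUStar (ρ r : ℝ) (u : ℂ) : Prop :=
  (1 - u) ^ (ρ : ℂ) * (1 + u) ^ ((1 - ρ : ℝ) : ℂ) = ((r ^ ρ : ℝ) : ℂ) ∧
    ρ * (1 - u).arg + (1 - ρ) * (1 + u).arg = 0 ∧ 0 < u.im

/-- The point `u_*(r)`, `r ≥ r_cr`, with `u_*(r_cr) = 1 - 2ρ`. -/
def uStar (ρ r : ℝ) : ℂ :=
  if r = rCrit ρ then ((1 - 2 * ρ : ℝ) : ℂ) else Classical.epsilon (IsUStar ρ r)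

/-- `1_{r > r_cr} G_∞(u_*(r))`. -/
def GLimit (ρ r : ℝ) : ℝ :=
  if rCrit ρ < r then GInf ρ (uStar ρ r) else 0

/-- `1_{r > r_cr} Λ_∞(u_*(r))`. -/
def LambdaLimit (ρ r : ℝ) : ℝ :=
  if rCrit ρ < r then LambdaInf ρ (uStar ρ r) else 0

end TASEP

end

/-!
Taking logarithms in the Bethe equation, the roots with label in `(0, p)` are the points of the
curve `ρ log (1 - u) + (1 - ρ) log (1 + u) = ρ log r + i (ψ - ρ π)`, `0 < ψ < ρ π`, in the upper
half plane, taken at equally spaced arguments `ψ = π x / N`; those with label in `(-p, 0)` are their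
conjugates. Along the curve the real parts of `u` and of `log (1 + u)` decrease. A sum over the
roots is therefore twice the real part of a Riemann sum of a bounded monotone function, so it
differs by `O(1)` from the integral, which is the variation of an explicit primitive. The curve
starts on the real axis, where the primitive is known; it ends on the real axis as well if
`r ≤ r_cr`, and at `u_*(r)` if `r > r_cr`, where the primitive takes the values `Λ_∞` and `G_∞`
up to normalization.
-/

noncomputable section

namespace TASEP

open Complex Set

open scoped Real ComplexConjugate

lemma injOn_of_im_deriv_neg {f f' : ℂ → ℂ} {s : Set ℂ} (hs : Convex ℝ s)
    (hf : ∀ z ∈ s, HasDerivAt f (f' z) z) (hf' : ∀ z ∈ s, (f' z).im < 0) : InjOn f s := by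
  intro a ha b hb hab
  by_contra hne
  have hba : b - a ≠ 0 := sub_ne_zero.2 (Ne.symm hne)
  let γ : ℝ → ℂ := AffineMap.lineMap a b
  have hγ : ∀ t ∈ Icc (0 : ℝ) 1, γ t ∈ s := fun t ht ↦
    hs.segment_subset ha hb (segment_eq_image_lineMap ℝ a b ▸ mem_image_of_mem _ ht)
  have hderiv : ∀ t ∈ Icc (0 : ℝ) 1,
      HasDerivAt (fun t ↦ (f (γ t) / (b - a)).im) (f' (γ t)).im t := by
    intro t ht
    have h := ((hf _ (hγ t ht)).comp t AffineMap.hasDerivAt_lineMap).div_const (b - a)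
    rw [mul_div_cancel_right₀ _ hba] at h
    exact imCLM.hasFDerivAt.comp_hasDerivAt t h
  obtain ⟨t, ht, hzero⟩ := exists_hasDerivAt_eq_zero zero_lt_one
    (fun t ht ↦ (hderiv t ht).continuousAt.continuousWithinAt) (by simp [γ, hab])
    (fun t ht ↦ hderiv t (Ioo_subset_Icc_self ht))
  exact (hf' _ (hγ t (Ioo_subset_Icc_self ht))).ne hzero

section RiemannSum

variable {T Δ M : ℝ} {φ h : ℝ → ℝ}

lemma exists_sub_eq_mul_of_hasDerivAt (hc : ContinuousOn h (Icc 0 T))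
    (hd : ∀ x ∈ Ioo 0 T, HasDerivAt h (φ x) x) {x y : ℝ} (hx : 0 ≤ x) (hxy : x < y)
    (hy : y ≤ T) : ∃ c ∈ Ioo x y, h y - h x = φ c * (y - x) := by
  obtain ⟨c, hcxy, hslope⟩ := exists_hasDerivAt_eq_slope h φ hxy (hc.mono (Icc_subset_Icc hx hy))
    (fun z hz ↦ hd z (Ioo_subset_Ioo hx hy hz))
  exact ⟨c, hcxy, by rw [hslope, div_mul_cancel₀ _ (sub_pos.2 hxy).ne']⟩

lemma abs_sub_le_of_hasDerivAt (hc : ContinuousOn h (Icc 0 T))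
    (hd : ∀ x ∈ Ioo 0 T, HasDerivAt h (φ x) x) (hM : ∀ x ∈ Ioo 0 T, |φ x| ≤ M) {x y : ℝ}
    (hx : 0 ≤ x) (hxy : x < y) (hy : y ≤ T) : |h y - h x| ≤ M * (y - x) := by
  obtain ⟨c, hcxy, hslope⟩ := exists_sub_eq_mul_of_hasDerivAt hc hd hx hxy hy
  rw [hslope, abs_mul, abs_of_pos (sub_pos.2 hxy)]
  exact mul_le_mul_of_nonneg_right (hM c (Ioo_subset_Ioo hx hy hcxy)) (sub_pos.2 hxy).le

lemma abs_riemannSum_sub_le_of_antitoneOn (hΔ : 0 < Δ) (hanti : AntitoneOn φ (Ioo 0 T))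
    (hc : ContinuousOn h (Icc 0 T)) (hd : ∀ x ∈ Ioo 0 T, HasDerivAt h (φ x) x) {x : ℝ}
    (hx : 0 < x) (n : ℕ) (hn : x + n * Δ < T) :
    |Δ * ∑ i ∈ Finset.range n, φ (x + i * Δ) - (h (x + n * Δ) - h x)|
      ≤ Δ * (φ x - φ (x + n * Δ)) := by
  induction n with
  | zero => simp
  | succ n ih =>
    have hsucc : x + ((n + 1 : ℕ) : ℝ) * Δ = x + n * Δ + Δ := by push_cast; ring
    rw [hsucc] at hn ⊢
    have hpos : 0 < x + n * Δ := by positivity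
    obtain ⟨c, hcxy, hslope⟩ :=
      exists_sub_eq_mul_of_hasDerivAt hc hd hpos.le (lt_add_of_pos_right _ hΔ) hn.le
    have hcT : c ∈ Ioo 0 T := ⟨hpos.trans hcxy.1, hcxy.2.trans hn⟩
    have hleft : φ c ≤ φ (x + n * Δ) := hanti ⟨hpos, by linarith⟩ hcT hcxy.1.le
    have hright : φ (x + n * Δ + Δ) ≤ φ c := hanti hcT ⟨by linarith, hn⟩ hcxy.2.le
    have hprev := abs_le.1 (ih (by linarith))
    rw [Finset.sum_range_succ, abs_le]
    constructor <;>
      nlinarith [mul_le_mul_of_nonneg_left hleft hΔ.le, mul_le_mul_of_nonneg_left hright hΔ.le]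

lemma abs_riemannSum_sub_le_of_continuousOn (hT : 0 < T) (hΔ : 0 < Δ)
    (hanti : AntitoneOn φ (Ioo 0 T)) (hM : ∀ x ∈ Ioo 0 T, |φ x| ≤ M)
    (hc : ContinuousOn h (Icc 0 T)) (hd : ∀ x ∈ Ioo 0 T, HasDerivAt h (φ x) x) {x : ℝ}
    (hx : 0 < x) (hxΔ : x ≤ Δ) (n : ℕ) (hn : T ≤ x + n * Δ) (hlt : ∀ i < n, x + i * Δ < T) :
    |Δ * ∑ i ∈ Finset.range n, φ (x + i * Δ) - (h T - h 0)| ≤ 5 * M * Δ := by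
  have hM0 : 0 ≤ M := (abs_nonneg _).trans (hM (T / 2) ⟨by linarith, by linarith⟩)
  cases n with
  | zero =>
    have hTΔ : T ≤ Δ := by simpa using hn.trans (by simpa using hxΔ)
    have hvar := abs_sub_le_of_hasDerivAt hc hd hM le_rfl hT le_rfl
    rw [Finset.range_zero, Finset.sum_empty, mul_zero, zero_sub, abs_neg]
    nlinarith
  | succ n =>
    have hlast : x + n * Δ < T := hlt n n.lt_succ_self
    have hxT : x < T := by simpa using hlt 0 n.succ_pos
    have hxn : x ≤ x + n * Δ := le_add_of_nonneg_right (by positivity)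
    have hmid := abs_le.1 (abs_riemannSum_sub_le_of_antitoneOn hΔ hanti hc hd hx n hlast)
    have hfirst := abs_le.1 (abs_sub_le_of_hasDerivAt hc hd hM le_rfl hx hxT.le)
    have hend := abs_le.1 (abs_sub_le_of_hasDerivAt hc hd hM (hx.le.trans hxn) hlast le_rfl)
    have hφx := abs_le.1 (hM x ⟨hx, hxT⟩)
    have hφn := abs_le.1 (hM _ ⟨hx.trans_le hxn, hlast⟩)
    have hgap : T - (x + n * Δ) ≤ Δ := by push_cast at hn; linarith
    rw [Finset.sum_range_succ, abs_le]
    constructor <;>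
      nlinarith [mul_le_mul_of_nonneg_left hgap hM0, mul_le_mul_of_nonneg_left hxΔ hM0,
        mul_le_mul_of_nonneg_left hφx.2 hΔ.le, mul_le_mul_of_nonneg_left hφn.1 hΔ.le,
        mul_le_mul_of_nonneg_left hφn.2 hΔ.le]

lemma abs_riemannSum_sub_le (hT : 0 < T) (hΔ : 0 < Δ) (hanti : AntitoneOn φ (Ioo 0 T))
    (hM : ∀ x ∈ Ioo 0 T, |φ x| ≤ M) (hd : ∀ x ∈ Ioo 0 T, HasDerivAt h (φ x) x) {a b : ℝ}
    (ha : Tendsto h (𝓝[>] 0) (𝓝 a)) (hb : Tendsto h (𝓝[<] T) (𝓝 b)) {x : ℝ}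
    (hx : 0 < x) (hxΔ : x ≤ Δ) (n : ℕ) (hn : T ≤ x + n * Δ) (hlt : ∀ i < n, x + i * Δ < T) :
    |Δ * ∑ i ∈ Finset.range n, φ (x + i * Δ) - (b - a)| ≤ 5 * M * Δ := by
  have hcont : ContinuousOn h (Ioo 0 T) := fun x hx ↦ (hd x hx).continuousAt.continuousWithinAt
  have hext : EqOn (extendFrom (Ioo 0 T) h) h (Ioo 0 T) := extendFrom_extends hcont
  have hderiv : ∀ y ∈ Ioo 0 T, HasDerivAt (extendFrom (Ioo 0 T) h) (φ y) y := fun y hy ↦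
    (hd y hy).congr_of_eventuallyEq (hext.eventuallyEq_of_mem (Ioo_mem_nhds hy.1 hy.2))
  have hbound := abs_riemannSum_sub_le_of_continuousOn hT hΔ hanti hM
    (continuousOn_Icc_extendFrom_Ioo hcont ha hb) hderiv hx hxΔ n hn hlt
  rwa [eq_lim_at_left_extendFrom_Ioo hT ha, eq_lim_at_right_extendFrom_Ioo hT hb] at hbound

end RiemannSum

lemma sum_Ico_eq_of_conj_symm {v : ℕ → ℂ} {n s : ℕ} (hs : 0 < s)
    (hv : ∀ i < n, v (n - i) = conj (v (n + s + i))) :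
    ∑ j ∈ Finset.Ico 1 (2 * n + s), v j
      = ((2 * ∑ i ∈ Finset.range n, (v (n + s + i)).re : ℝ) : ℂ)
        + ∑ j ∈ Finset.Ico (n + 1) (n + s), v j := by
  have hupper : ∑ j ∈ Finset.Ico (n + s) (2 * n + s), v j
      = ∑ i ∈ Finset.range n, v (n + s + i) := by
    rw [Finset.sum_Ico_eq_sum_range]
    congr 2
    omega
  have hlower : ∑ j ∈ Finset.Ico 1 (n + 1), v j
      = ∑ i ∈ Finset.range n, conj (v (n + s + i)) := by
    rw [Finset.sum_Ico_eq_sum_range, ← Finset.sum_range_reflect, Nat.add_sub_cancel]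
    refine Finset.sum_congr rfl fun i hi ↦ ?_
    rw [Finset.mem_range] at hi
    rw [← hv i hi]
    congr 1
    omega
  rw [← Finset.sum_Ico_consecutive v (show 1 ≤ n + 1 by omega) (by omega),
    ← Finset.sum_Ico_consecutive v (show n + 1 ≤ n + s by omega) (by omega), hupper, hlower,
    add_left_comm, ← Finset.sum_add_distrib, add_comm]
  simp only [add_comm (conj _), add_conj, ← ofReal_sum, ← Finset.mul_sum]

lemma norm_sum_sub_le_of_conj_symm {p q : ℕ} (hp : 0 < p) (hpq : p ≤ q) (hqp : q ≤ p + 1)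
    {M a b : ℝ} {v : ℕ → ℂ} {φ : ℝ → ℂ} {h : ℝ → ℝ}
    (hφ : ∀ x ∈ Ioo 0 (p : ℝ), φ (-x) = conj (φ x))
    (hv : ∀ j, 0 < j → j < q → 2 * j ≠ q → v j = φ (2 * j - q))
    (hvM : ∀ j, 0 < j → j ≤ p → ‖v j‖ ≤ M)
    (hanti : AntitoneOn (fun x ↦ (φ x).re) (Ioo 0 (p : ℝ)))
    (hM : ∀ x ∈ Ioo 0 (p : ℝ), |(φ x).re| ≤ M)
    (hd : ∀ x ∈ Ioo 0 (p : ℝ), HasDerivAt h (φ x).re x)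
    (ha : Tendsto h (𝓝[>] 0) (𝓝 a)) (hb : Tendsto h (𝓝[<] (p : ℝ)) (𝓝 b)) :
    ‖∑ j ∈ Finset.Icc 1 p, v j - ((b - a : ℝ) : ℂ)‖ ≤ 12 * M := by
  have hM0 : 0 ≤ M := (norm_nonneg _).trans (hvM 1 one_pos hp)
  obtain ⟨n, s, hs0, hs2, rfl⟩ : ∃ n s : ℕ, 0 < s ∧ s ≤ 2 ∧ q = 2 * n + s :=
    ⟨(q - 1) / 2, q - 2 * ((q - 1) / 2), by omega, by omega, by omega⟩
  have hupper : ∀ i < n, v (n + s + i) = φ (s + i * 2) := fun i hi ↦ by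
    rw [hv _ (by omega) (by omega) (by omega)]
    congr 1; push_cast; ring
  have hlower : ∀ i < n, v (n - i) = conj (v (n + s + i)) := fun i hi ↦ by
    rw [hupper i hi, ← hφ _ ⟨by positivity, by exact_mod_cast (by omega : s + i * 2 < p)⟩,
      hv _ (by omega) (by omega) (by omega)]
    congr 1; push_cast [hi.le]; ring
  have hriemann : |2 * ∑ i ∈ Finset.range n, (v (n + s + i)).re - (b - a)| ≤ 5 * M * 2 := by
    rw [Finset.sum_congr rfl fun i hi ↦ by rw [hupper i (Finset.mem_range.1 hi)]]
    refine abs_riemannSum_sub_le (Nat.cast_pos.2 hp) two_pos hanti hM hd ha hb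
      (Nat.cast_pos.2 hs0) (by exact_mod_cast hs2) n ?_ fun i hi ↦ ?_
    · exact_mod_cast (by omega : p ≤ s + n * 2)
    · exact_mod_cast (by omega : s + i * 2 < p)
  have hmiddle : ‖∑ j ∈ Finset.Ico (n + 1) (n + s), v j‖ ≤ M := by
    obtain rfl | rfl : s = 1 ∨ s = 2 := by omega
    · simpa using hM0
    · simpa using hvM (n + 1) (by omega) (by omega)
  obtain ⟨w, hw, hlast⟩ : ∃ w : ℂ, ‖w‖ ≤ M ∧
      ∑ j ∈ Finset.Icc 1 p, v j = ∑ j ∈ Finset.Ico 1 (2 * n + s), v j + w := by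
    obtain h | h : 2 * n + s = p ∨ 2 * n + s = p + 1 := by omega
    · exact ⟨v p, hvM p hp le_rfl, by rw [h, ← Finset.sum_Ico_succ_top hp]; rfl⟩
    · exact ⟨0, by simpa using hM0, by rw [add_zero, h]; rfl⟩
  rw [hlast, sum_Ico_eq_of_conj_symm hs0 hlower, add_assoc, add_sub_right_comm, ← ofReal_sub]
  calc _ ≤ _ + (_ + _) := (norm_add_le _ _).trans (add_le_add_right (norm_add_le _ _) _)
    _ ≤ 5 * M * 2 + (M + M) := by
      gcongr
      rwa [norm_real]
    _ = 12 * M := by ring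

section Dilogarithm

variable {z : ℂ}

lemma one_sub_mul_mem_slitPlane (hz : 1 - z ∈ slitPlane) {t : ℝ} (ht : t ∈ Icc (0 : ℝ) 1) :
    1 - t * z ∈ slitPlane := by
  rw [sub_eq_add_neg] at hz
  simpa [sub_eq_add_neg] using starConvex_one_slitPlane.add_smul_mem hz ht.1 ht.2

lemma intervalIntegrable_log_one_sub_mul_div (hz : 1 - z ∈ slitPlane) :
    IntervalIntegrable (fun t : ℝ ↦ log (1 - t * z) / t) MeasureTheory.volume 0 1 := by
  let s : Set ℝ := (fun t : ℝ ↦ 1 - t * z) ⁻¹' slitPlane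
  have hs : s ∈ 𝓝 0 := (isOpen_slitPlane.preimage (by fun_prop)).mem_nhds (by simp)
  have hlog : ∀ t ∈ s, DifferentiableAt ℝ (fun t : ℝ ↦ log (1 - t * z)) t := fun t ht ↦
    (((ofRealCLM.hasDerivAt.mul_const z).const_sub 1).clog_real ht).differentiableAt
  -- The integrand is the difference quotient of `log (1 - t z)` at `0`, so it extends continuously.
  have hslope : ContinuousOn (dslope (fun t : ℝ ↦ log (1 - t * z)) 0) s :=
    (continuousOn_dslope hs).2
      ⟨fun t ht ↦ (hlog t ht).continuousAt.continuousWithinAt, hlog 0 (mem_of_mem_nhds hs)⟩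
  refine ((hslope.mono fun t ht ↦ one_sub_mul_mem_slitPlane hz ht).intervalIntegrable_of_Icc
    zero_le_one).congr fun t ht ↦ ?_
  rw [uIoc_of_le zero_le_one] at ht
  simp [dslope_of_ne _ ht.1.ne', slope_def_module, div_eq_inv_mul]

lemma exists_bound_inv_one_sub_mul (hz : 1 - z ∈ slitPlane) :
    ∃ s ∈ 𝓝 z, ∃ B : ℝ, ∀ w ∈ s, 1 - w ∈ slitPlane ∧
      ∀ t ∈ Icc (0 : ℝ) 1, ‖(1 - t * w)⁻¹‖ ≤ B := by
  obtain ⟨ε, hε, hball⟩ := Metric.nhds_basis_closedBall.mem_iff.1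
    ((isOpen_slitPlane.preimage (by fun_prop : Continuous fun w : ℂ ↦ 1 - w)).mem_nhds hz)
  have hcont : ContinuousOn (fun x : ℂ × ℝ ↦ (1 - x.2 * x.1)⁻¹)
      (Metric.closedBall z ε ×ˢ Icc (0 : ℝ) 1) :=
    ContinuousOn.inv₀ (by fun_prop) fun x hx ↦
      slitPlane_ne_zero (one_sub_mul_mem_slitPlane (hball hx.1) hx.2)
  obtain ⟨B, hB⟩ := ((isCompact_closedBall z ε).prod isCompact_Icc).exists_bound_of_continuousOn
    hcont
  exact ⟨_, Metric.closedBall_mem_nhds z hε, B, fun w hw ↦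
    ⟨hball hw, fun t ht ↦ hB (w, t) ⟨hw, ht⟩⟩⟩

lemma hasDerivAt_dilog_integral (hz : 1 - z ∈ slitPlane) :
    HasDerivAt dilog (∫ t in (0 : ℝ)..1, (1 - t * z)⁻¹) z := by
  obtain ⟨s, hs, B, hB⟩ := exists_bound_inv_one_sub_mul hz
  have hmem : ∀ {t : ℝ}, t ∈ uIoc (0 : ℝ) 1 → t ∈ Icc (0 : ℝ) 1 := fun ht ↦
    Ioc_subset_Icc_self (uIoc_of_le (zero_le_one (α := ℝ)) ▸ ht)
  have hderiv := (intervalIntegral.hasDerivAt_integral_of_dominated_loc_of_deriv_le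
    (F := fun (w : ℂ) (t : ℝ) ↦ log (1 - t * w) / t) (F' := fun w t ↦ -(1 - t * w)⁻¹)
    (bound := fun _ ↦ B) hs
    (.of_forall fun w ↦ Measurable.aestronglyMeasurable (by fun_prop))
    (intervalIntegrable_log_one_sub_mul_div hz) (Measurable.aestronglyMeasurable (by fun_prop))
    (.of_forall fun t ht w hw ↦ by simpa using (hB w hw).2 t (hmem ht))
    intervalIntegrable_const (.of_forall fun t ht w hw ↦ ?_)).2.neg
  · rw [intervalIntegral.integral_neg, neg_neg] at hderiv
    exact hderiv
  · have hslit := one_sub_mul_mem_slitPlane (hB w hw).1 (hmem ht)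
    have ht0 : (t : ℂ) ≠ 0 := ofReal_ne_zero.2 (uIoc_of_le (zero_le_one (α := ℝ)) ▸ ht).1.ne'
    refine ((((hasDerivAt_id w).const_mul (t : ℂ)).const_sub 1).clog hslit
      |>.div_const (t : ℂ)).congr_deriv ?_
    field_simp
    rfl

lemma hasDerivAt_dilog (hz : 1 - z ∈ slitPlane) (hz0 : z ≠ 0) :
    HasDerivAt dilog (-(log (1 - z) / z)) z := by
  have hlog : -log (1 - z) = z * ∫ t in (0 : ℝ)..1, (1 - t * z)⁻¹ := by
    simpa only [real_smul, log_inv _ (slitPlane_arg_ne_pi hz)] using log_inv_eq_integral hz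
  rw [← neg_div, hlog, mul_div_cancel_left₀ _ hz0]
  exact hasDerivAt_dilog_integral hz

lemma im_dilog_ofReal {x : ℝ} (hx : x < 1) : (dilog x).im = 0 := by
  have hreal : ∫ t in (0 : ℝ)..1, log (1 - t * x) / t
      = ((∫ t in (0 : ℝ)..1, Real.log (1 - t * x) / t : ℝ) : ℂ) := by
    rw [← intervalIntegral.integral_ofReal]
    refine intervalIntegral.integral_congr fun t ht ↦ ?_
    rw [uIcc_of_le zero_le_one] at ht
    have hpos : 0 ≤ 1 - t * x := by nlinarith [ht.1, ht.2]
    push_cast [ofReal_log hpos]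
    rfl
  rw [dilog, hreal, neg_im, ofReal_im, neg_zero]

end Dilogarithm

section LevelMap

variable {ρ : ℝ} {u : ℂ}

/-- The logarithm of `(1 - u) ^ ρ * (1 + u) ^ (1 - ρ)`, with principal branches. For `p = ρ N`, the
Bethe equation prescribes its real part and the labels are read off its imaginary part. -/
def logLevel (ρ : ℝ) (u : ℂ) : ℂ := ρ * log (1 - u) + (1 - ρ : ℝ) * log (1 + u)

/-- The derivative of `logLevel`. -/
def logLevelDeriv (ρ : ℝ) (u : ℂ) : ℂ := (1 - ρ : ℝ) * (1 + u)⁻¹ - ρ * (1 - u)⁻¹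

lemma logLevel_re (ρ : ℝ) (u : ℂ) :
    (logLevel ρ u).re = ρ * Real.log ‖1 - u‖ + (1 - ρ) * Real.log ‖1 + u‖ := by
  simp only [logLevel, add_re, re_ofReal_mul, log_re]

lemma logLevel_im (ρ : ℝ) (u : ℂ) :
    (logLevel ρ u).im = ρ * arg (1 - u) + (1 - ρ) * arg (1 + u) := by
  simp only [logLevel, add_im, im_ofReal_mul, log_im]

lemma one_sub_mem_slitPlane (hu : 0 < u.im) : 1 - u ∈ slitPlane :=
  mem_slitPlane_iff.2 (.inr (by simpa using hu.ne'))

lemma one_add_mem_slitPlane (hu : 0 < u.im) : 1 + u ∈ slitPlane :=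
  mem_slitPlane_iff.2 (.inr (by simpa using hu.ne'))

lemma one_sub_ne_zero_of_im_pos (hu : 0 < u.im) : 1 - u ≠ 0 :=
  slitPlane_ne_zero (one_sub_mem_slitPlane hu)

lemma one_add_ne_zero_of_im_pos (hu : 0 < u.im) : 1 + u ≠ 0 :=
  slitPlane_ne_zero (one_add_mem_slitPlane hu)

lemma arg_one_add_pos (hu : 0 < u.im) : 0 < arg (1 + u) :=
  (arg_nonneg_iff.2 (by simpa using hu.le)).lt_of_ne' fun h ↦
    hu.ne' (by simpa using (arg_eq_zero_iff.1 h).2)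

lemma arg_one_sub_neg (hu : 0 < u.im) : arg (1 - u) < 0 :=
  arg_neg_iff.2 (by simpa using hu)

lemma hasStrictDerivAt_log_one_sub (hu : 0 < u.im) :
    HasStrictDerivAt (fun u ↦ log (1 - u)) (-(1 - u)⁻¹) u := by
  simpa [neg_div] using ((hasStrictDerivAt_id u).const_sub 1).clog (one_sub_mem_slitPlane hu)

lemma hasStrictDerivAt_log_one_add (hu : 0 < u.im) :
    HasStrictDerivAt (fun u ↦ log (1 + u)) (1 + u)⁻¹ u := by
  simpa using ((hasStrictDerivAt_id u).const_add 1).clog (one_add_mem_slitPlane hu)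

lemma hasStrictDerivAt_logLevel (ρ : ℝ) (hu : 0 < u.im) :
    HasStrictDerivAt (logLevel ρ) (logLevelDeriv ρ u) u :=
  (((hasStrictDerivAt_log_one_sub hu).const_mul (ρ : ℂ)).add
    ((hasStrictDerivAt_log_one_add hu).const_mul ((1 - ρ : ℝ) : ℂ))).congr_deriv
    (by unfold logLevelDeriv; ring)

lemma im_inv_one_sub_pos (hu : 0 < u.im) : 0 < ((1 - u)⁻¹).im := by
  have hnorm : 0 < normSq (1 - u) := normSq_pos.2 (one_sub_ne_zero_of_im_pos hu)
  simpa [inv_im] using div_pos hu hnorm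

lemma im_inv_one_add_neg (hu : 0 < u.im) : ((1 + u)⁻¹).im < 0 := by
  have hnorm : 0 < normSq (1 + u) := normSq_pos.2 (one_add_ne_zero_of_im_pos hu)
  simpa [inv_im, neg_div] using div_pos hu hnorm

lemma logLevelDeriv_im_neg (hρ : ρ ∈ Ioo (0 : ℝ) 1) (hu : 0 < u.im) :
    (logLevelDeriv ρ u).im < 0 := by
  rw [logLevelDeriv, sub_im, im_ofReal_mul, im_ofReal_mul]
  have hsub := mul_pos hρ.1 (im_inv_one_sub_pos hu)
  have hadd := mul_neg_of_pos_of_neg (sub_pos.2 hρ.2) (im_inv_one_add_neg hu)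
  linarith

lemma logLevelDeriv_ne_zero (hρ : ρ ∈ Ioo (0 : ℝ) 1) (hu : 0 < u.im) : logLevelDeriv ρ u ≠ 0 :=
  fun h ↦ (logLevelDeriv_im_neg hρ hu).ne (by rw [h, zero_im])

lemma logLevel_injOn (hρ : ρ ∈ Ioo (0 : ℝ) 1) : InjOn (logLevel ρ) {u | 0 < u.im} :=
  injOn_of_im_deriv_neg (convex_halfSpace_im_gt 0)
    (fun _ hu ↦ (hasStrictDerivAt_logLevel ρ hu).hasDerivAt)
    (fun _ hu ↦ logLevelDeriv_im_neg hρ hu)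

end LevelMap

section LevelPoint

variable {ρ r ψ : ℝ} {u : ℂ}

/-- The value of `logLevel` at the point of the level curve of radius `r` with parameter `ψ`. The
parameter is the sum of the angles at which the point is seen from `1` and from `-1`, weighted by
`ρ` and `1 - ρ`. -/
def levelValue (ρ r ψ : ℝ) : ℂ := (ρ * Real.log r : ℝ) + (ψ - ρ * π : ℝ) * I

/-- `u` is the point of the upper half plane on the level curve of radius `r` with parameter
`ψ`. -/
def IsLevelPoint (ρ r ψ : ℝ) (u : ℂ) : Prop := 0 < u.im ∧ logLevel ρ u = levelValue ρ r ψ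

/-- Parametrization of the level curve of radius `r` in the upper half plane. The value is arbitrary
when there is no point with parameter `ψ`. -/
def levelPoint (ρ r ψ : ℝ) : ℂ := Classical.epsilon (IsLevelPoint ρ r ψ)

lemma levelValue_re (ρ r ψ : ℝ) : (levelValue ρ r ψ).re = ρ * Real.log r := by simp [levelValue]

lemma levelValue_im (ρ r ψ : ℝ) : (levelValue ρ r ψ).im = ψ - ρ * π := by simp [levelValue]

lemma isLevelPoint_iff : IsLevelPoint ρ r ψ u ↔ 0 < u.im ∧
    ρ * Real.log ‖1 - u‖ + (1 - ρ) * Real.log ‖1 + u‖ = ρ * Real.log r ∧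
    ρ * arg (1 - u) + (1 - ρ) * arg (1 + u) = ψ - ρ * π := by
  rw [IsLevelPoint, Complex.ext_iff, logLevel_re, logLevel_im, levelValue_re, levelValue_im]

lemma IsLevelPoint.eq_levelPoint (hρ : ρ ∈ Ioo (0 : ℝ) 1) (hu : IsLevelPoint ρ r ψ u) :
    levelPoint ρ r ψ = u := by
  have hspec : IsLevelPoint ρ r ψ (levelPoint ρ r ψ) := Classical.epsilon_spec ⟨u, hu⟩
  exact logLevel_injOn hρ hspec.1 hu.1 (hspec.2.trans hu.2.symm)

lemma IsLevelPoint.mul_arg_one_add_lt (hρ : 0 < ρ) (hu : IsLevelPoint ρ r ψ u) :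
    (1 - ρ) * arg (1 + u) < ψ := by
  have hangle := (isLevelPoint_iff.1 hu).2.2
  have hlt := mul_lt_mul_of_pos_left (neg_pi_lt_arg (1 - u)) hρ
  linarith

lemma IsLevelPoint.hasDerivAt (hρ : ρ ∈ Ioo (0 : ℝ) 1) (hu : IsLevelPoint ρ r ψ u) :
    HasDerivAt (levelPoint ρ r) (I / logLevelDeriv ρ u) ψ := by
  have hstrict := hasStrictDerivAt_logLevel ρ hu.1
  have hne := logLevelDeriv_ne_zero hρ hu.1
  let g := hstrict.localInverse _ _ _ hne
  have hvalue : HasDerivAt (levelValue ρ r) I ψ := by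
    have hangle := ((hasDerivAt_id ψ).sub_const (ρ * π)).ofReal_comp.mul_const I
    rw [ofReal_one, one_mul] at hangle
    exact hangle.const_add ((ρ * Real.log r : ℝ) : ℂ)
  have hg : HasDerivAt g (logLevelDeriv ρ u)⁻¹ (levelValue ρ r ψ) :=
    hu.2 ▸ (hstrict.to_localInverse hne).hasDerivAt
  have hcomp := hg.comp ψ hvalue
  have hgu : g (levelValue ρ r ψ) = u := hu.2 ▸ (hstrict.eventually_left_inverse hne).self_of_nhds
  have him : ∀ᶠ x in 𝓝 ψ, 0 < (g (levelValue ρ r x)).im :=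
    (continuous_im.continuousAt.comp hcomp.continuousAt).eventually_const_lt
      (by simpa [hgu] using hu.1)
  have hinv : ∀ᶠ x in 𝓝 ψ, logLevel ρ (g (levelValue ρ r x)) = levelValue ρ r x :=
    hvalue.continuousAt.eventually (hu.2 ▸ hstrict.eventually_right_inverse hne)
  refine (hcomp.congr_of_eventuallyEq ?_).congr_deriv (by ring)
  filter_upwards [him, hinv] with x hx hx'
  exact IsLevelPoint.eq_levelPoint hρ ⟨hx, hx'⟩

end LevelPoint

section Existence

variable {ρ r ψ : ℝ}

-- The law of sines in the triangle with vertices `-1`, `1`, `u`.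
lemma exists_of_viewing_angles {α β : ℝ} (hα : 0 < α) (hαβ : α < β) (hβ : β < π) :
    ∃ u : ℂ, 0 < u.im ∧ arg (1 + u) = α ∧ arg (1 - u) = β - π ∧
      ‖1 + u‖ = 2 * Real.sin β / Real.sin (β - α) ∧
      ‖1 - u‖ = 2 * Real.sin α / Real.sin (β - α) := by
  have hsinα : 0 < Real.sin α := Real.sin_pos_of_pos_of_lt_pi hα (hαβ.trans hβ)
  have hsinβ : 0 < Real.sin β := Real.sin_pos_of_pos_of_lt_pi (hα.trans hαβ) hβ
  have hsin : 0 < Real.sin (β - α) := Real.sin_pos_of_pos_of_lt_pi (by linarith) (by linarith)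
  set a := 2 * Real.sin β / Real.sin (β - α) with ha
  set b := 2 * Real.sin α / Real.sin (β - α) with hb
  have ha0 : 0 < a := by positivity
  have hb0 : 0 < b := by positivity
  obtain ⟨u, hu⟩ : ∃ u, 1 + u = a * (cos α + sin α * I) := ⟨_, add_sub_cancel _ _⟩
  have hu' : 1 - u = b * (cos (β - π : ℝ) + sin (β - π : ℝ) * I) := by
    rw [show 1 - u = 2 - (1 + u) by ring, hu, ← ofReal_cos, ← ofReal_cos, ← ofReal_sin,
      ← ofReal_sin, Real.cos_sub_pi, Real.sin_sub_pi]
    apply Complex.ext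
    · suffices 2 - a * Real.cos α = -(b * Real.cos β) by simpa
      rw [ha, hb]
      field_simp
      rw [Real.sin_sub]
      ring
    · suffices a * Real.sin α = b * Real.sin β by simpa
      rw [ha, hb]
      ring
  refine ⟨u, ?_, ?_, ?_, ?_, ?_⟩
  · have him := congrArg im hu
    simp only [add_im, one_im, zero_add, im_ofReal_mul, ← ofReal_cos, ← ofReal_sin, ofReal_im,
      I_im, mul_one] at him
    rw [him]
    positivity
  · rw [hu, arg_mul_cos_add_sin_mul_I ha0 ⟨by linarith, by linarith⟩]
  · rw [hu', arg_mul_cos_add_sin_mul_I hb0 ⟨by linarith, by linarith⟩]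
  · rw [hu, norm_mul, norm_cos_add_sin_mul_I, mul_one, norm_real, Real.norm_of_nonneg ha0.le]
  · rw [hu', norm_mul, norm_cos_add_sin_mul_I, mul_one, norm_real, Real.norm_of_nonneg hb0.le]

/-- The defect in the equation of the level curve of radius `r` at the point of the upper half plane
with parameter `ψ` that is seen from `-1` at the angle `α`, multiplied by a positive factor. -/
def levelDefect (ρ r ψ α : ℝ) : ℝ :=
  2 * Real.sin α ^ ρ * Real.sin ((ψ - (1 - ρ) * α) / ρ) ^ (1 - ρ) - r ^ ρ * Real.sin ((ψ - α) / ρ)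

lemma exists_isLevelPoint_of_levelDefect_eq_zero (hρ : ρ ∈ Ioo (0 : ℝ) 1) (hr : 0 < r)
    (hψ : ψ ≤ ρ * π) {α : ℝ} (hα : α ∈ Ioo 0 ψ) (h : levelDefect ρ r ψ α = 0) :
    ∃ u, IsLevelPoint ρ r ψ u ∧ arg (1 + u) = α := by
  obtain ⟨hρ0, hρ1⟩ := hρ
  set β := (ψ - (1 - ρ) * α) / ρ with hβ
  have hψβ : ψ = ρ * β + (1 - ρ) * α := by rw [hβ]; field_simp; ring
  have hαβ : α < β := by rw [hβ, lt_div_iff₀ hρ0]; linarith [hα.2]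
  have hβπ : β < π := by rw [hβ, div_lt_iff₀ hρ0]; nlinarith [hα.1]
  have hsinα : 0 < Real.sin α := Real.sin_pos_of_pos_of_lt_pi hα.1 (hαβ.trans hβπ)
  have hsinβ : 0 < Real.sin β := Real.sin_pos_of_pos_of_lt_pi (hα.1.trans hαβ) hβπ
  have hsin : 0 < Real.sin (β - α) :=
    Real.sin_pos_of_pos_of_lt_pi (by linarith) (by linarith [hα.1])
  obtain ⟨u, hu, hadd, hsub, hnadd, hnsub⟩ := exists_of_viewing_angles hα.1 hαβ hβπ
  refine ⟨u, isLevelPoint_iff.2 ⟨hu, ?_, by rw [hadd, hsub, hψβ]; ring⟩, hadd⟩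
  have hdiff : (ψ - α) / ρ = β - α := by rw [hψβ]; field_simp; ring
  have hlevel : 2 * Real.sin α ^ ρ * Real.sin β ^ (1 - ρ) = r ^ ρ * Real.sin (β - α) := by
    rw [levelDefect, ← hβ, hdiff] at h
    linarith
  have hlog := congrArg Real.log hlevel
  rw [Real.log_mul (by positivity) (by positivity), Real.log_mul (by positivity) (by positivity),
    Real.log_mul (by positivity) (by positivity), Real.log_rpow hsinα, Real.log_rpow hsinβ,
    Real.log_rpow hr] at hlog
  rw [hnadd, hnsub, Real.log_div (by positivity) (by positivity),
    Real.log_div (by positivity) (by positivity), Real.log_mul (by positivity) (by positivity),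
    Real.log_mul (by positivity) (by positivity)]
  linear_combination hlog

lemma continuous_levelDefect (hρ : ρ ∈ Ioo (0 : ℝ) 1) (r : ℝ) :
    Continuous fun x : ℝ × ℝ ↦ levelDefect ρ r x.1 x.2 := by
  have hangle : Continuous fun x : ℝ × ℝ ↦ (x.1 - (1 - ρ) * x.2) / ρ := by fun_prop
  have hsin := (Real.continuous_sin.comp continuous_snd).rpow_const
    fun _ : ℝ × ℝ ↦ .inr hρ.1.le
  have hsin' := (Real.continuous_sin.comp hangle).rpow_const
    fun _ ↦ .inr (sub_pos.2 hρ.2).le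
  exact ((hsin.const_mul 2).mul hsin').sub (by fun_prop)

lemma exists_isLevelPoint_of_levelDefect (hρ : ρ ∈ Ioo (0 : ℝ) 1) (hr : 0 < r)
    (hψ : ψ ≤ ρ * π) {a b : ℝ} (ha0 : 0 ≤ a) (hab : a ≤ b) (hbψ : b ≤ ψ)
    (ha : levelDefect ρ r ψ a < 0) (hb : 0 < levelDefect ρ r ψ b) :
    ∃ u, IsLevelPoint ρ r ψ u ∧ arg (1 + u) < b := by
  have hcont : Continuous (levelDefect ρ r ψ) := (continuous_levelDefect hρ r).along_snd
  obtain ⟨α, hα, hzero⟩ := intermediate_value_Ioo hab hcont.continuousOn ⟨ha, hb⟩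
  obtain ⟨u, hu, hangle⟩ := exists_isLevelPoint_of_levelDefect_eq_zero hρ hr hψ
    (Ioo_subset_Ioo ha0 hbψ hα) hzero
  exact ⟨u, hu, hangle ▸ hα.2⟩

lemma levelDefect_zero_neg (hρ : 0 < ρ) (hr : 0 < r) (hψ : ψ ∈ Ioo 0 (ρ * π)) :
    levelDefect ρ r ψ 0 < 0 := by
  have hsin : 0 < Real.sin (ψ / ρ) :=
    Real.sin_pos_of_pos_of_lt_pi (div_pos hψ.1 hρ) (by rw [div_lt_iff₀' hρ]; exact hψ.2)
  have hpos : 0 < r ^ ρ * Real.sin (ψ / ρ) := by positivity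
  simpa [levelDefect, Real.zero_rpow hρ.ne'] using hpos

lemma levelDefect_self_pos (hρ : 0 < ρ) (hψ : ψ ∈ Ioo 0 π) : 0 < levelDefect ρ r ψ ψ := by
  have hsin : 0 < Real.sin ψ := Real.sin_pos_of_pos_of_lt_pi hψ.1 hψ.2
  have hangle : (ψ - (1 - ρ) * ψ) / ρ = ψ := by field_simp; ring
  rw [levelDefect, hangle, sub_self, zero_div, Real.sin_zero, mul_zero, sub_zero]
  positivity

lemma isLevelPoint_levelPoint (hρ : ρ ∈ Ioo (0 : ℝ) 1) (hr : 0 < r) (hψ : ψ ∈ Ioo 0 (ρ * π)) :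
    IsLevelPoint ρ r ψ (levelPoint ρ r ψ) := by
  have hψπ : ψ < π := hψ.2.trans (mul_lt_of_lt_one_left Real.pi_pos hρ.2)
  obtain ⟨u, hu, -⟩ := exists_isLevelPoint_of_levelDefect hρ hr hψ.2.le le_rfl hψ.1.le le_rfl
    (levelDefect_zero_neg hρ.1 hr hψ) (levelDefect_self_pos hρ.1 ⟨hψ.1, hψπ⟩)
  exact Classical.epsilon_spec ⟨u, hu⟩

end Existence

section Critical

variable {ρ r : ℝ}

lemma rCrit_pos (hρ : ρ ∈ Ioo (0 : ℝ) 1) : 0 < rCrit ρ := by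
  obtain ⟨hρ0, hρ1⟩ := hρ
  have : 0 < 1 - ρ := sub_pos.2 hρ1
  unfold rCrit
  positivity

lemma rCrit_rpow_mul (hρ : ρ ∈ Ioo (0 : ℝ) 1) {x : ℝ} (hx : 0 < x) :
    rCrit ρ ^ ρ * x = 2 * (ρ * x) ^ ρ * ((1 - ρ) * x) ^ (1 - ρ) := by
  obtain ⟨hρ0, hρ1⟩ := hρ
  have hρ' : 0 < 1 - ρ := sub_pos.2 hρ1
  have hcrit : rCrit ρ ^ ρ = 2 * ρ ^ ρ * (1 - ρ) ^ (1 - ρ) := by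
    rw [rCrit, Real.mul_rpow (by positivity) (by positivity),
      Real.mul_rpow (by positivity) (by positivity), ← Real.rpow_mul (by positivity),
      ← Real.rpow_mul hρ'.le, div_mul_cancel₀ _ hρ0.ne', Real.rpow_one, sub_mul,
      div_mul_cancel₀ _ hρ0.ne', one_mul]
  have hpow : x ^ ρ * x ^ (1 - ρ) = x := by
    rw [← Real.rpow_add hx, add_sub_cancel, Real.rpow_one]
  rw [hcrit, Real.mul_rpow hρ0.le hx.le, Real.mul_rpow hρ'.le hx.le]
  linear_combination -(2 * ρ ^ ρ * (1 - ρ) ^ (1 - ρ)) * hpow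

lemma levelDefect_mul_pi (hρ : ρ ≠ 0) (r x : ℝ) : levelDefect ρ r (ρ * π) (ρ * x) =
    2 * Real.sin (ρ * x) ^ ρ * Real.sin ((1 - ρ) * x) ^ (1 - ρ) - r ^ ρ * Real.sin x := by
  have hx : (ρ * π - ρ * x) / ρ = π - x := by field_simp
  have hx' : (ρ * π - (1 - ρ) * (ρ * x)) / ρ = π - (1 - ρ) * x := by field_simp
  rw [levelDefect, hx, hx', Real.sin_pi_sub, Real.sin_pi_sub]

lemma mul_sin_lt_sin_mul {c x : ℝ} (hc : c ∈ Ioo (0 : ℝ) 1) (hx : x ∈ Ioo 0 π) :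
    c * Real.sin x < Real.sin (c * x) := by
  simpa using strictConcaveOn_sin_Icc.2 ⟨le_rfl, Real.pi_pos.le⟩ (Ioo_subset_Icc_self hx)
    hx.1.ne (sub_pos.2 hc.2) hc.1 (sub_add_cancel 1 c)

lemma levelDefect_mul_pi_pos (hρ : ρ ∈ Ioo (0 : ℝ) 1) (hr : 0 ≤ r) (hrc : r ≤ rCrit ρ) {α : ℝ}
    (hα : α ∈ Ioo 0 (ρ * π)) : 0 < levelDefect ρ r (ρ * π) α := by
  obtain ⟨x, rfl⟩ : ∃ x, α = ρ * x := ⟨α / ρ, (mul_div_cancel₀ _ hρ.1.ne').symm⟩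
  have hρ' : 1 - ρ ∈ Ioo (0 : ℝ) 1 := ⟨sub_pos.2 hρ.2, sub_lt_self 1 hρ.1⟩
  have hx : x ∈ Ioo 0 π := ⟨pos_of_mul_pos_right hα.1 hρ.1.le, lt_of_mul_lt_mul_left hα.2 hρ.1.le⟩
  have hsin : 0 < Real.sin x := Real.sin_pos_of_pos_of_lt_pi hx.1 hx.2
  have h0 := hρ.1
  have h0' := hρ'.1
  rw [levelDefect_mul_pi hρ.1.ne', sub_pos]
  calc r ^ ρ * Real.sin x ≤ rCrit ρ ^ ρ * Real.sin x := by gcongr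
    _ = 2 * (ρ * Real.sin x) ^ ρ * ((1 - ρ) * Real.sin x) ^ (1 - ρ) := rCrit_rpow_mul hρ hsin
    _ < 2 * Real.sin (ρ * x) ^ ρ * Real.sin ((1 - ρ) * x) ^ (1 - ρ) := by
        gcongr
        · exact mul_sin_lt_sin_mul hρ hx
        · exact mul_sin_lt_sin_mul hρ' hx

lemma exists_mul_lt_mul_sin {a b : ℝ} (ha : 0 < a) (hab : a < b) :
    ∃ x ∈ Ioo 0 π, a * x < b * Real.sin x := by
  have hb : 0 < b := ha.trans hab
  obtain ⟨x, hx⟩ : ∃ x, x = 1 - a / b := ⟨_, rfl⟩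
  have hx0 : 0 < x := by rw [hx, sub_pos, div_lt_one hb]; exact hab
  have hx1 : x < 1 := by rw [hx]; linarith [div_pos ha hb]
  refine ⟨x, ⟨hx0, by linarith [Real.pi_gt_three]⟩, ?_⟩
  have ha' : a = b * (1 - x) := by rw [hx]; field_simp; ring
  rw [ha', mul_assoc]
  gcongr
  nlinarith [Real.sin_gt_sub_cube hx0, mul_pos hx0 hx0]

lemma exists_levelDefect_mul_pi_neg (hρ : ρ ∈ Ioo (0 : ℝ) 1) (hrc : rCrit ρ < r) :
    ∃ α ∈ Ioo 0 (ρ * π), levelDefect ρ r (ρ * π) α < 0 := by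
  have hcrit := rCrit_pos hρ
  obtain ⟨x, hx, hlt⟩ := exists_mul_lt_mul_sin (Real.rpow_pos_of_pos hcrit ρ)
    (Real.rpow_lt_rpow hcrit.le hrc hρ.1)
  obtain ⟨hρ0, hρ1⟩ := hρ
  have hρ' : 0 < 1 - ρ := sub_pos.2 hρ1
  have hx0 := hx.1
  have hsin_le {c : ℝ} (hc : 0 < c) : Real.sin (c * x) ≤ c * x := Real.sin_le (by positivity)
  have hsin_nonneg {c : ℝ} (hc : 0 < c) (hc1 : c < 1) : 0 ≤ Real.sin (c * x) :=
    Real.sin_nonneg_of_nonneg_of_le_pi (by positivity) (by nlinarith [hx.2])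
  refine ⟨ρ * x, ⟨by positivity, mul_lt_mul_of_pos_left hx.2 hρ0⟩, ?_⟩
  rw [levelDefect_mul_pi hρ0.ne', sub_neg]
  calc 2 * Real.sin (ρ * x) ^ ρ * Real.sin ((1 - ρ) * x) ^ (1 - ρ)
      ≤ 2 * (ρ * x) ^ ρ * ((1 - ρ) * x) ^ (1 - ρ) := by
        gcongr
        · exact Real.rpow_nonneg (hsin_nonneg hρ' (sub_lt_self 1 hρ0)) _
        · exact hsin_nonneg hρ0 hρ1
        · exact hsin_le hρ0
        · exact hsin_nonneg hρ' (sub_lt_self 1 hρ0)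
        · exact hsin_le hρ'
    _ = rCrit ρ ^ ρ * x := (rCrit_rpow_mul ⟨hρ0, hρ1⟩ hx0).symm
    _ < r ^ ρ * Real.sin x := hlt

lemma cpow_mul_cpow_eq_exp_logLevel {u : ℂ} (hu : 0 < u.im) :
    (1 - u) ^ (ρ : ℂ) * (1 + u) ^ ((1 - ρ : ℝ) : ℂ) = exp (logLevel ρ u) := by
  rw [cpow_def_of_ne_zero (one_sub_ne_zero_of_im_pos hu),
    cpow_def_of_ne_zero (one_add_ne_zero_of_im_pos hu), ← exp_add, logLevel, mul_comm (log _),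
    mul_comm (log _)]

lemma isUStar_iff (hr : 0 < r) {u : ℂ} : IsUStar ρ r u ↔ IsLevelPoint ρ r (ρ * π) u := by
  have hrρ : r ^ ρ = Real.exp (ρ * Real.log r) := by rw [Real.rpow_def_of_pos hr, mul_comm]
  constructor
  · rintro ⟨hlevel, hangle, hu⟩
    refine ⟨hu, Complex.ext ?_ ?_⟩
    · rw [cpow_mul_cpow_eq_exp_logLevel hu, hrρ, ofReal_exp] at hlevel
      have hnorm := congrArg norm hlevel
      rwa [norm_exp, norm_exp, Real.exp_eq_exp, ofReal_re, ← levelValue_re ρ r (ρ * π)] at hnorm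
    · rw [logLevel_im, levelValue_im, hangle, sub_self]
  · rintro ⟨hu, hlevel⟩
    refine ⟨?_, ?_, hu⟩
    · rw [cpow_mul_cpow_eq_exp_logLevel hu, hlevel, hrρ, ofReal_exp, levelValue]
      simp only [sub_self, ofReal_zero, zero_mul, add_zero]
    · rw [← logLevel_im, hlevel, levelValue_im, sub_self]

lemma isLevelPoint_uStar (hρ : ρ ∈ Ioo (0 : ℝ) 1) (hrc : rCrit ρ < r) :
    IsLevelPoint ρ r (ρ * π) (uStar ρ r) := by
  have hr : 0 < r := (rCrit_pos hρ).trans hrc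
  have hρπ : ρ * π ∈ Ioo 0 π :=
    ⟨mul_pos hρ.1 Real.pi_pos, mul_lt_of_lt_one_left Real.pi_pos hρ.2⟩
  obtain ⟨a, ha, hneg⟩ := exists_levelDefect_mul_pi_neg hρ hrc
  obtain ⟨u, hu, -⟩ := exists_isLevelPoint_of_levelDefect hρ hr le_rfl ha.1.le ha.2.le le_rfl
    hneg (levelDefect_self_pos hρ.1 hρπ)
  rw [← isUStar_iff hr, uStar, if_neg hrc.ne']
  exact Classical.epsilon_spec ⟨u, (isUStar_iff hr).2 hu⟩

lemma tendsto_levelPoint_uStar (hρ : ρ ∈ Ioo (0 : ℝ) 1) (hrc : rCrit ρ < r) :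
    Tendsto (levelPoint ρ r) (𝓝[<] (ρ * π)) (𝓝 (uStar ρ r)) := by
  have hu := isLevelPoint_uStar hρ hrc
  have hcont := (hu.hasDerivAt hρ).continuousAt.tendsto
  rw [hu.eq_levelPoint hρ] at hcont
  exact hcont.mono_left nhdsWithin_le_nhds

end Critical

section Monotonicity

variable {ρ r ψ : ℝ} {u : ℂ}

lemma IsLevelPoint.hasDerivAt_comp (hρ : ρ ∈ Ioo (0 : ℝ) 1) (hu : IsLevelPoint ρ r ψ u)
    {A : ℂ → ℂ} {a : ℂ} (hA : HasDerivAt A (a * logLevelDeriv ρ u) u) :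
    HasDerivAt (fun ψ ↦ A (levelPoint ρ r ψ)) (a * I) ψ := by
  have hne := logLevelDeriv_ne_zero hρ hu.1
  rw [← hu.eq_levelPoint hρ] at hA
  refine (hA.comp ψ (hu.hasDerivAt hρ)).congr_deriv ?_
  rw [hu.eq_levelPoint hρ]
  field_simp

lemma hasDerivAt_im_comp_levelPoint (hρ : ρ ∈ Ioo (0 : ℝ) 1) (hr : 0 < r)
    (hψ : ψ ∈ Ioo 0 (ρ * π)) {A a : ℂ → ℂ}
    (hA : ∀ u, 0 < u.im → HasDerivAt A (a u * logLevelDeriv ρ u) u) :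
    HasDerivAt (fun ψ ↦ (A (levelPoint ρ r ψ)).im) (a (levelPoint ρ r ψ)).re ψ := by
  have hu := isLevelPoint_levelPoint hρ hr hψ
  simpa [Function.comp_def] using
    imCLM.hasFDerivAt.comp_hasDerivAt ψ (hu.hasDerivAt_comp hρ (hA _ hu.1))

lemma antitoneOn_re_comp_levelPoint (hρ : ρ ∈ Ioo (0 : ℝ) 1) (hr : 0 < r) {A a : ℂ → ℂ}
    (hA : ∀ u, 0 < u.im → HasDerivAt A (a u * logLevelDeriv ρ u) u)
    (ha : ∀ u, 0 < u.im → 0 ≤ (a u).im) :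
    AntitoneOn (fun ψ ↦ (A (levelPoint ρ r ψ)).re) (Ioo 0 (ρ * π)) := by
  have hderiv : ∀ ψ ∈ Ioo 0 (ρ * π), HasDerivAt (fun ψ ↦ (A (levelPoint ρ r ψ)).re)
      (-(a (levelPoint ρ r ψ)).im) ψ := fun ψ hψ ↦ by
    have hu := isLevelPoint_levelPoint hρ hr hψ
    simpa [Function.comp_def] using
      reCLM.hasFDerivAt.comp_hasDerivAt ψ (hu.hasDerivAt_comp hρ (hA _ hu.1))
  refine antitoneOn_of_hasDerivWithinAt_nonpos (convex_Ioo _ _)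
    (fun ψ hψ ↦ (hderiv ψ hψ).continuousAt.continuousWithinAt)
    (fun ψ hψ ↦ (hderiv ψ (interior_subset hψ)).hasDerivWithinAt) fun ψ hψ ↦ ?_
  exact neg_nonpos.2 (ha _ (isLevelPoint_levelPoint hρ hr (interior_subset hψ)).1)

lemma im_inv_nonneg {z : ℂ} (hz : z.im ≤ 0) : 0 ≤ z⁻¹.im := by
  rw [inv_im]
  exact div_nonneg (neg_nonneg.2 hz) (normSq_nonneg z)

lemma antitoneOn_re_levelPoint (hρ : ρ ∈ Ioo (0 : ℝ) 1) (hr : 0 < r) :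
    AntitoneOn (fun ψ ↦ (levelPoint ρ r ψ).re) (Ioo 0 (ρ * π)) := by
  refine antitoneOn_re_comp_levelPoint (A := fun u ↦ u) (a := fun u ↦ (logLevelDeriv ρ u)⁻¹)
    hρ hr (fun u hu ↦ ?_) fun u hu ↦ im_inv_nonneg (logLevelDeriv_im_neg hρ hu).le
  rw [inv_mul_cancel₀ (logLevelDeriv_ne_zero hρ hu)]
  exact hasDerivAt_id' u

lemma antitoneOn_re_log_one_add_levelPoint (hρ : ρ ∈ Ioo (0 : ℝ) 1) (hr : 0 < r) :
    AntitoneOn (fun ψ ↦ (log (1 + levelPoint ρ r ψ)).re) (Ioo 0 (ρ * π)) := by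
  refine antitoneOn_re_comp_levelPoint (A := fun u ↦ log (1 + u))
    (a := fun u ↦ ((1 + u) * logLevelDeriv ρ u)⁻¹) hρ hr (fun u hu ↦ ?_) fun u hu ↦ ?_
  · refine (hasStrictDerivAt_log_one_add hu).hasDerivAt.congr_deriv ?_
    rw [mul_inv, mul_assoc, inv_mul_cancel₀ (logLevelDeriv_ne_zero hρ hu), mul_one]
  · have hadd := one_add_ne_zero_of_im_pos hu
    have hsub := one_sub_ne_zero_of_im_pos hu
    have heq : (1 + u) * logLevelDeriv ρ u = (1 : ℝ) - (2 * ρ : ℝ) * (1 - u)⁻¹ := by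
      unfold logLevelDeriv
      push_cast
      field_simp
      ring
    refine im_inv_nonneg ?_
    rw [heq, sub_im, ofReal_im, im_ofReal_mul, zero_sub, neg_nonpos]
    exact mul_nonneg (mul_nonneg zero_le_two hρ.1.le) (im_inv_one_sub_pos hu).le

end Monotonicity

section Bounds

variable {ρ r R ψ : ℝ} {u : ℂ}

/-- A lower bound for `‖1 + u‖` on the level curves. -/
def distBound (ρ : ℝ) : ℝ := min 1 (2 * (1 - ρ) / (ρ * π))

/-- A region that contains the level curves of radius at most `R` in the upper half plane, their
conjugates, and their ends on the real axis. -/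
def levelRegion (ρ R : ℝ) : Set ℂ := {u | ‖u‖ ≤ 1 + R ∧ distBound ρ ≤ ‖1 + u‖}

/-- A bound for `‖log (1 + u)‖` on `levelRegion ρ R`. -/
def logBound (ρ R : ℝ) : ℝ := |Real.log (distBound ρ)| + |Real.log (2 + R)| + π

lemma distBound_pos (hρ : ρ ∈ Ioo (0 : ℝ) 1) : 0 < distBound ρ :=
  lt_min one_pos (div_pos (mul_pos two_pos (sub_pos.2 hρ.2)) (mul_pos hρ.1 Real.pi_pos))

lemma isClosed_levelRegion : IsClosed (levelRegion ρ R) :=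
  (isClosed_le continuous_norm continuous_const).inter
    (isClosed_le continuous_const (continuous_const.add continuous_id).norm)

lemma conj_mem_levelRegion (hu : u ∈ levelRegion ρ R) : conj u ∈ levelRegion ρ R := by
  have hconj : 1 + conj u = conj (1 + u) := by rw [map_add, map_one]
  rwa [levelRegion, mem_ofPred_eq, hconj, norm_conj, norm_conj]

lemma norm_log_one_add_le (hρ : ρ ∈ Ioo (0 : ℝ) 1) (hu : u ∈ levelRegion ρ R) :
    ‖log (1 + u)‖ ≤ logBound ρ R := by
  have hdist := distBound_pos hρ
  have hnorm : ‖1 + u‖ ≤ 2 + R := by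
    have htri := norm_add_le 1 u
    rw [norm_one] at htri
    linarith [hu.1]
  have hlog : |Real.log ‖1 + u‖| ≤ |Real.log (distBound ρ)| + |Real.log (2 + R)| :=
    (abs_le_max_abs_abs (Real.log_le_log hdist hu.2)
      (Real.log_le_log (hdist.trans_le hu.2) hnorm)).trans
      (max_le_add_of_nonneg (abs_nonneg _) (abs_nonneg _))
  calc ‖log (1 + u)‖ ≤ |(log (1 + u)).re| + |(log (1 + u)).im| := norm_le_abs_re_add_abs_im _
    _ ≤ logBound ρ R := by
      rw [log_re, log_im]
      exact add_le_add hlog (abs_arg_le_pi _)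

lemma norm_le_of_logLevel_re_le (hρ : ρ ∈ Ioo (0 : ℝ) 1) (hR : 1 ≤ R)
    (h : (logLevel ρ u).re ≤ ρ * Real.log R) : ‖u‖ ≤ 1 + R := by
  by_contra! hlt
  have hpos : 0 < ‖u‖ - 1 := by linarith
  have hsub : ‖u‖ - 1 ≤ ‖1 - u‖ := by simpa [norm_sub_rev] using norm_sub_norm_le u 1
  have hadd : ‖u‖ - 1 ≤ ‖1 + u‖ := by simpa [add_comm] using norm_sub_norm_le u (-1)
  have hlog : Real.log R < Real.log (‖u‖ - 1) := Real.log_lt_log (by linarith) (by linarith)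
  have hlogR := Real.log_nonneg hR
  have hρ' : 0 ≤ 1 - ρ := (sub_pos.2 hρ.2).le
  have hρ0 := hρ.1.le
  rw [logLevel_re] at h
  have : Real.log (‖u‖ - 1) ≤ ρ * Real.log R := calc
    Real.log (‖u‖ - 1) = ρ * Real.log (‖u‖ - 1) + (1 - ρ) * Real.log (‖u‖ - 1) := by ring
    _ ≤ ρ * Real.log ‖1 - u‖ + (1 - ρ) * Real.log ‖1 + u‖ := by gcongr
    _ ≤ ρ * Real.log R := h
  nlinarith [mul_nonneg hρ' hlogR]

lemma im_le_norm_mul_arg {z : ℂ} (hz : 0 ≤ arg z) : z.im ≤ ‖z‖ * arg z := by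
  rw [← norm_mul_sin_arg]
  gcongr
  exact Real.sin_le hz

lemma norm_mul_neg_arg_le {z : ℂ} (hre : 0 ≤ z.re) (harg : arg z ≤ 0) :
    ‖z‖ * (2 / π * -arg z) ≤ -z.im := by
  rw [← norm_mul_sin_arg, ← mul_neg, ← Real.sin_neg]
  gcongr
  exact Real.mul_le_sin (neg_nonneg.2 harg)
    ((neg_le_abs _).trans (abs_arg_le_pi_div_two_iff.2 hre))

lemma distBound_le_norm (hρ : 0 < ρ) (hu : 0 < u.im) (h : (logLevel ρ u).im ≤ 0) :
    distBound ρ ≤ ‖1 + u‖ := by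
  rcases le_or_gt 1 ‖1 + u‖ with hone | hone
  · exact (min_le_left _ _).trans hone
  refine (min_le_right _ _).trans ?_
  rw [logLevel_im] at h
  have hadd := arg_one_add_pos hu
  have hsub := arg_one_sub_neg hu
  have htwo : 1 - u = 2 - (1 + u) := by ring
  have hre : 0 ≤ (1 - u).re := by
    rw [htwo, sub_re, re_ofNat]
    linarith [re_le_norm (1 + u)]
  have hnorm : 1 ≤ ‖1 - u‖ := by
    have htri := norm_sub_norm_le 2 (1 + u)
    rw [← htwo, Complex.norm_ofNat] at htri
    linarith
  have hchain : 2 / π * -arg (1 - u) ≤ ‖1 + u‖ * arg (1 + u) := calc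
    2 / π * -arg (1 - u) ≤ ‖1 - u‖ * (2 / π * -arg (1 - u)) :=
      le_mul_of_one_le_left (mul_nonneg (by positivity) (neg_nonneg.2 hsub.le)) hnorm
    _ ≤ u.im := by simpa using norm_mul_neg_arg_le hre hsub.le
    _ ≤ ‖1 + u‖ * arg (1 + u) := by simpa using im_le_norm_mul_arg hadd.le
  refine le_of_mul_le_mul_right ?_ hadd
  calc 2 * (1 - ρ) / (ρ * π) * arg (1 + u) = 2 / (ρ * π) * ((1 - ρ) * arg (1 + u)) := by ring
    _ ≤ 2 / (ρ * π) * (ρ * -arg (1 - u)) :=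
      mul_le_mul_of_nonneg_left (by linarith) (by positivity)
    _ = 2 / π * -arg (1 - u) := by field_simp
    _ ≤ ‖1 + u‖ * arg (1 + u) := hchain

lemma levelPoint_mem_levelRegion (hρ : ρ ∈ Ioo (0 : ℝ) 1) (hr : 0 < r) (hrR : r ≤ R) (hR : 1 ≤ R)
    (hψ : ψ ∈ Ioo 0 (ρ * π)) : levelPoint ρ r ψ ∈ levelRegion ρ R := by
  obtain ⟨him, hlevel⟩ := isLevelPoint_levelPoint hρ hr hψ
  refine ⟨norm_le_of_logLevel_re_le hρ hR ?_, distBound_le_norm hρ.1 him ?_⟩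
  · rw [hlevel, levelValue_re]
    exact mul_le_mul_of_nonneg_left (Real.log_le_log hr hrR) hρ.1.le
  · rw [hlevel, levelValue_im]
    exact sub_nonpos.2 hψ.2.le

end Bounds

section RealEnds

variable {ρ r : ℝ} {l : Filter ℝ}

lemma tendsto_arg_one_add_levelPoint_zero (hρ : ρ ∈ Ioo (0 : ℝ) 1) (hr : 0 < r) :
    Tendsto (fun ψ ↦ arg (1 + levelPoint ρ r ψ)) (𝓝[>] 0) (𝓝 0) := by
  have hev : ∀ᶠ ψ in 𝓝[>] (0 : ℝ), ψ ∈ Ioo 0 (ρ * π) :=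
    Ioo_mem_nhdsGT (mul_pos hρ.1 Real.pi_pos)
  have hlim : Tendsto (fun ψ : ℝ ↦ ψ / (1 - ρ)) (𝓝[>] 0) (𝓝 0) := by
    simpa using (tendsto_id.div_const (1 - ρ)).mono_left (nhdsWithin_le_nhds (a := (0 : ℝ)))
  refine tendsto_of_tendsto_of_tendsto_of_le_of_le' tendsto_const_nhds hlim ?_ ?_
  · filter_upwards [hev] with ψ hψ
    exact (arg_one_add_pos (isLevelPoint_levelPoint hρ hr hψ).1).le
  · filter_upwards [hev] with ψ hψ
    rw [le_div_iff₀' (sub_pos.2 hρ.2)]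
    exact ((isLevelPoint_levelPoint hρ hr hψ).mul_arg_one_add_lt hρ.1).le

lemma tendsto_arg_one_add_levelPoint_mul_pi (hρ : ρ ∈ Ioo (0 : ℝ) 1) (hr : 0 < r)
    (hrc : r ≤ rCrit ρ) :
    Tendsto (fun ψ ↦ arg (1 + levelPoint ρ r ψ)) (𝓝[<] (ρ * π)) (𝓝 0) := by
  have hρπ : 0 < ρ * π := mul_pos hρ.1 Real.pi_pos
  have hev : ∀ᶠ ψ in 𝓝[<] (ρ * π), ψ ∈ Ioo 0 (ρ * π) := Ioo_mem_nhdsLT hρπ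
  refine tendsto_order.2 ⟨fun a ha ↦ ?_, fun a ha ↦ ?_⟩
  · filter_upwards [hev] with ψ hψ
    exact ha.trans (arg_one_add_pos (isLevelPoint_levelPoint hρ hr hψ).1)
  obtain ⟨b, hb0, hb⟩ := exists_between (lt_min ha hρπ)
  obtain ⟨hba, hbπ⟩ := lt_min_iff.1 hb
  have hcont : Continuous fun ψ ↦ levelDefect ρ r ψ b := (continuous_levelDefect hρ r).along_fst
  have hpos : ∀ᶠ ψ in 𝓝[<] (ρ * π), 0 < levelDefect ρ r ψ b :=
    (hcont.continuousAt.eventually_const_lt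
      (levelDefect_mul_pi_pos hρ hr.le hrc ⟨hb0, hbπ⟩)).filter_mono nhdsWithin_le_nhds
  filter_upwards [hev, hpos, Ioo_mem_nhdsLT hbπ] with ψ hψ hdefect hbψ
  obtain ⟨u, hu, hlt⟩ := exists_isLevelPoint_of_levelDefect hρ hr hψ.2.le le_rfl hb0.le hbψ.1.le
    (levelDefect_zero_neg hρ.1 hr hψ) hdefect
  rw [hu.eq_levelPoint hρ]
  exact hlt.trans hba

lemma image_re_log_one_add_levelPoint_subset (hρ : ρ ∈ Ioo (0 : ℝ) 1) (hr : 0 < r) :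
    (fun ψ ↦ (log (1 + levelPoint ρ r ψ)).re) '' Ioo 0 (ρ * π) ⊆
      Icc (-logBound ρ (max 1 r)) (logBound ρ (max 1 r)) := by
  rintro _ ⟨ψ, hψ, rfl⟩
  exact abs_le.1 ((abs_re_le_norm _).trans (norm_log_one_add_le hρ
    (levelPoint_mem_levelRegion hρ hr (le_max_right 1 r) (le_max_left 1 r) hψ)))

lemma exists_tendsto_levelPoint_of_log (hmem : ∀ᶠ ψ in l, ψ ∈ Ioo 0 (ρ * π))
    (hρ : ρ ∈ Ioo (0 : ℝ) 1) (hr : 0 < r) {c : ℝ}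
    (hre : Tendsto (fun ψ ↦ (log (1 + levelPoint ρ r ψ)).re) l (𝓝 c))
    (harg : Tendsto (fun ψ ↦ arg (1 + levelPoint ρ r ψ)) l (𝓝 0)) :
    ∃ x : ℝ, -1 < x ∧ Tendsto (levelPoint ρ r) l (𝓝 x) := by
  refine ⟨Real.exp c - 1, by linarith [Real.exp_pos c], ?_⟩
  have hexp : Tendsto (fun ψ ↦ exp ((log (1 + levelPoint ρ r ψ)).re
      + arg (1 + levelPoint ρ r ψ) * I) - 1) l (𝓝 (exp (c + (0 : ℝ) * I) - 1)) := by
    refine ((continuous_exp.tendsto _).comp ?_).sub_const 1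
    exact ((continuous_ofReal.tendsto _).comp hre).add
      (((continuous_ofReal.tendsto _).comp harg).mul_const I)
  simp only [ofReal_zero, zero_mul, add_zero] at hexp
  rw [ofReal_sub, ofReal_exp, ofReal_one]
  refine hexp.congr' ?_
  filter_upwards [hmem] with ψ hψ
  rw [← log_im, re_add_im,
    exp_log (one_add_ne_zero_of_im_pos (isLevelPoint_levelPoint hρ hr hψ).1), add_sub_cancel_left]

lemma exists_tendsto_levelPoint_zero (hρ : ρ ∈ Ioo (0 : ℝ) 1) (hr : 0 < r) :
    ∃ x : ℝ, -1 < x ∧ Tendsto (levelPoint ρ r) (𝓝[>] 0) (𝓝 x) := by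
  have hρπ : 0 < ρ * π := mul_pos hρ.1 Real.pi_pos
  exact exists_tendsto_levelPoint_of_log (Ioo_mem_nhdsGT hρπ) hρ hr
    ((antitoneOn_re_log_one_add_levelPoint hρ hr).tendsto_nhdsWithin_Ioo_right
      (nonempty_Ioo.2 hρπ) (bddAbove_Icc.mono (image_re_log_one_add_levelPoint_subset hρ hr)))
    (tendsto_arg_one_add_levelPoint_zero hρ hr)

lemma exists_tendsto_levelPoint_mul_pi (hρ : ρ ∈ Ioo (0 : ℝ) 1) (hr : 0 < r)
    (hrc : r ≤ rCrit ρ) : ∃ x : ℝ, -1 < x ∧ Tendsto (levelPoint ρ r) (𝓝[<] (ρ * π)) (𝓝 x) := by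
  have hρπ : 0 < ρ * π := mul_pos hρ.1 Real.pi_pos
  exact exists_tendsto_levelPoint_of_log (Ioo_mem_nhdsLT hρπ) hρ hr
    ((antitoneOn_re_log_one_add_levelPoint hρ hr).tendsto_nhdsWithin_Ioo_left
      (nonempty_Ioo.2 hρπ) (bddBelow_Icc.mono (image_re_log_one_add_levelPoint_subset hρ hr)))
    (tendsto_arg_one_add_levelPoint_mul_pi hρ hr hrc)

end RealEnds

section Primitives

variable {ρ r ψ₀ x : ℝ} {u : ℂ} {l : Filter ℝ}

/-- The primitive of `(u - 1) * logLevelDeriv ρ u`. -/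
def primLambda (ρ : ℝ) (u : ℂ) : ℂ := u - (2 * (1 - ρ) : ℝ) * log (1 + u)

/-- The primitive of `log (1 + u) * logLevelDeriv ρ u`. -/
def primG (ρ : ℝ) (u : ℂ) : ℂ :=
  ((1 - ρ) / 2 : ℝ) * log (1 + u) ^ 2 - ρ * dilog (1 / 2 - u / 2)
    + (ρ * Real.log 2 : ℝ) * log (1 - u)

lemma hasDerivAt_primLambda (ρ : ℝ) (hu : 0 < u.im) :
    HasDerivAt (primLambda ρ) ((u - 1) * logLevelDeriv ρ u) u := by
  have hsub := one_sub_ne_zero_of_im_pos hu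
  have hadd := one_add_ne_zero_of_im_pos hu
  refine ((hasDerivAt_id u).sub ((hasStrictDerivAt_log_one_add hu).hasDerivAt.const_mul
    ((2 * (1 - ρ) : ℝ) : ℂ))).congr_deriv ?_
  unfold logLevelDeriv
  push_cast
  field_simp
  ring

lemma one_sub_half_sub_half (u : ℂ) : 1 - (1 / 2 - u / 2) = ((2⁻¹ : ℝ) : ℂ) * (1 + u) := by
  push_cast
  ring

lemma hasDerivAt_dilog_half_sub_half (hu : 0 < u.im) :
    HasDerivAt (fun u ↦ dilog (1 / 2 - u / 2)) ((log (1 + u) - Real.log 2) / (1 - u)) u := by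
  have hsub := one_sub_ne_zero_of_im_pos hu
  have hne : 1 / 2 - u / 2 ≠ 0 := by
    rw [← sub_div]
    exact div_ne_zero hsub two_ne_zero
  have hslit : 1 - (1 / 2 - u / 2) ∈ slitPlane :=
    mem_slitPlane_iff.2 (.inr (by simpa using hu.ne'))
  have hinner : HasDerivAt (fun u : ℂ ↦ 1 / 2 - u / 2) (-(1 / 2)) u :=
    ((hasDerivAt_id u).div_const 2).const_sub (1 / 2)
  refine ((hasDerivAt_dilog hslit hne).comp u hinner).congr_deriv ?_
  rw [one_sub_half_sub_half, log_ofReal_mul (by positivity) (one_add_ne_zero_of_im_pos hu),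
    Real.log_inv, ofReal_neg, ← sub_div]
  field_simp
  ring

lemma hasDerivAt_primG (ρ : ℝ) (hu : 0 < u.im) :
    HasDerivAt (primG ρ) (log (1 + u) * logLevelDeriv ρ u) u := by
  have hsub := one_sub_ne_zero_of_im_pos hu
  have hadd := one_add_ne_zero_of_im_pos hu
  refine (((((hasStrictDerivAt_log_one_add hu).hasDerivAt.pow 2).const_mul
    (((1 - ρ) / 2 : ℝ) : ℂ)).sub ((hasDerivAt_dilog_half_sub_half hu).const_mul (ρ : ℂ))).add
    ((hasStrictDerivAt_log_one_sub hu).hasDerivAt.const_mul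
      ((ρ * Real.log 2 : ℝ) : ℂ))).congr_deriv ?_
  unfold logLevelDeriv
  push_cast
  field_simp
  ring

lemma primLambda_im (ρ : ℝ) (u : ℂ) :
    (primLambda ρ u).im = u.im - 2 * (1 - ρ) * arg (1 + u) := by
  rw [primLambda, sub_im, im_ofReal_mul, log_im]

lemma primG_im (ρ : ℝ) (u : ℂ) :
    (primG ρ u).im = (1 - ρ) * Real.log ‖1 + u‖ * arg (1 + u) - ρ * (dilog (1 / 2 - u / 2)).im
      + Real.log 2 * (ρ * arg (1 - u)) := by
  rw [primG, add_im, sub_im, im_ofReal_mul, im_ofReal_mul, im_ofReal_mul, sq, mul_im, log_im,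
    log_im, log_re]
  ring

lemma mul_LambdaInf (ρ : ℝ) (u : ℂ) : 2 * π * LambdaInf ρ u = (primLambda ρ u).im := by
  rw [LambdaInf, primLambda_im]
  field_simp
  ring

lemma mul_GInf (hρ : ρ ≠ 0) (u : ℂ) : ρ * π * GInf ρ u = (primG ρ u).im := by
  rw [GInf, primG_im]
  field_simp
  ring

lemma one_add_ofReal_mem_slitPlane (hx : -1 < x) : 1 + (x : ℂ) ∈ slitPlane :=
  mem_slitPlane_iff.2 (.inl (by simpa using neg_lt_iff_pos_add'.1 hx))

lemma arg_one_add_ofReal (hx : -1 < x) : arg (1 + x) = 0 := by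
  rw [← ofReal_one, ← ofReal_add]
  exact arg_ofReal_of_nonneg (by linarith)

lemma tendsto_im_primLambda_of_tendsto_ofReal (hx : -1 < x)
    (hlim : Tendsto (levelPoint ρ r) l (𝓝 x)) :
    Tendsto (fun ψ ↦ (primLambda ρ (levelPoint ρ r ψ)).im) l (𝓝 0) := by
  have harg := (continuousAt_arg (one_add_ofReal_mem_slitPlane hx)).tendsto.comp
    (hlim.const_add 1)
  rw [arg_one_add_ofReal hx] at harg
  simp only [primLambda_im]
  simpa using ((continuous_im.tendsto _).comp hlim).sub (harg.const_mul (2 * (1 - ρ)))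

lemma tendsto_im_primG_of_tendsto_ofReal (hρ : ρ ∈ Ioo (0 : ℝ) 1) (hr : 0 < r) (hl : l ≤ 𝓝 ψ₀)
    (hmem : ∀ᶠ ψ in l, ψ ∈ Ioo 0 (ρ * π)) (hx : -1 < x)
    (hlim : Tendsto (levelPoint ρ r) l (𝓝 x)) :
    Tendsto (fun ψ ↦ (primG ρ (levelPoint ρ r ψ)).im) l (𝓝 (Real.log 2 * (ψ₀ - ρ * π))) := by
  have hslit := one_add_ofReal_mem_slitPlane hx
  have hadd : Tendsto (fun ψ ↦ 1 + levelPoint ρ r ψ) l (𝓝 (1 + x)) := hlim.const_add 1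
  have harg : Tendsto (fun ψ ↦ arg (1 + levelPoint ρ r ψ)) l (𝓝 0) :=
    arg_one_add_ofReal hx ▸ (continuousAt_arg hslit).tendsto.comp hadd
  have hlog : Tendsto (fun ψ ↦ Real.log ‖1 + levelPoint ρ r ψ‖) l (𝓝 (Real.log ‖1 + (x : ℂ)‖)) :=
    hadd.norm.log (norm_ne_zero_iff.2 (slitPlane_ne_zero hslit))
  have hdilog : Tendsto (fun ψ ↦ (dilog (1 / 2 - levelPoint ρ r ψ / 2)).im) l (𝓝 0) := by
    have hcast : (1 / 2 - x / 2 : ℂ) = (1 / 2 - x / 2 : ℝ) := by push_cast; rfl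
    have hre : (1 - (1 / 2 - x / 2) : ℂ).re = 1 / 2 + x / 2 := by
      rw [hcast, ← ofReal_one, ← ofReal_sub, ofReal_re]
      ring
    have hcont : ContinuousAt dilog (1 / 2 - x / 2) := by
      refine (hasDerivAt_dilog_integral ?_).continuousAt
      exact mem_slitPlane_iff.2 (.inl (by rw [hre]; linarith))
    rw [← im_dilog_ofReal (x := 1 / 2 - x / 2) (by linarith), ← hcast]
    exact ((continuous_im.tendsto _).comp hcont.tendsto).comp ((hlim.div_const 2).const_sub _)
  -- `log (1 - u)` may be discontinuous at the end point, but the level equation controls its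
  -- imaginary part.
  have harg' : Tendsto (fun ψ ↦ ρ * arg (1 - levelPoint ρ r ψ)) l (𝓝 (ψ₀ - ρ * π)) := by
    have htend := ((tendsto_id.mono_left hl).sub_const (ρ * π)).sub (harg.const_mul (1 - ρ))
    rw [mul_zero, sub_zero] at htend
    refine htend.congr' ?_
    filter_upwards [hmem] with ψ hψ
    have hangle := (isLevelPoint_iff.1 (isLevelPoint_levelPoint hρ hr hψ)).2.2
    simp only [id]
    linarith
  simp only [primG_im]
  simpa using (((hlog.const_mul (1 - ρ)).mul harg).sub (hdilog.const_mul ρ)).add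
    (harg'.const_mul (Real.log 2))

lemma tendsto_im_primLambda_zero (hρ : ρ ∈ Ioo (0 : ℝ) 1) (hr : 0 < r) :
    Tendsto (fun ψ ↦ (primLambda ρ (levelPoint ρ r ψ)).im) (𝓝[>] 0) (𝓝 0) := by
  obtain ⟨x, hx, hlim⟩ := exists_tendsto_levelPoint_zero hρ hr
  exact tendsto_im_primLambda_of_tendsto_ofReal hx hlim

lemma tendsto_im_primG_zero (hρ : ρ ∈ Ioo (0 : ℝ) 1) (hr : 0 < r) :
    Tendsto (fun ψ ↦ (primG ρ (levelPoint ρ r ψ)).im) (𝓝[>] 0)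
      (𝓝 (-(ρ * π * Real.log 2))) := by
  obtain ⟨x, hx, hlim⟩ := exists_tendsto_levelPoint_zero hρ hr
  convert tendsto_im_primG_of_tendsto_ofReal hρ hr nhdsWithin_le_nhds
    (Ioo_mem_nhdsGT (mul_pos hρ.1 Real.pi_pos)) hx hlim using 2
  ring

lemma tendsto_im_primLambda_mul_pi (hρ : ρ ∈ Ioo (0 : ℝ) 1) (hr : 0 < r) :
    Tendsto (fun ψ ↦ (primLambda ρ (levelPoint ρ r ψ)).im) (𝓝[<] (ρ * π))
      (𝓝 (2 * π * LambdaLimit ρ r)) := by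
  rw [LambdaLimit]
  split_ifs with hrc
  · rw [mul_LambdaInf]
    have hcont := (hasDerivAt_primLambda ρ (isLevelPoint_uStar hρ hrc).1).continuousAt
    exact (continuous_im.tendsto _).comp (hcont.tendsto.comp (tendsto_levelPoint_uStar hρ hrc))
  · obtain ⟨x, hx, hlim⟩ := exists_tendsto_levelPoint_mul_pi hρ hr (not_lt.1 hrc)
    rw [mul_zero]
    exact tendsto_im_primLambda_of_tendsto_ofReal hx hlim

lemma tendsto_im_primG_mul_pi (hρ : ρ ∈ Ioo (0 : ℝ) 1) (hr : 0 < r) :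
    Tendsto (fun ψ ↦ (primG ρ (levelPoint ρ r ψ)).im) (𝓝[<] (ρ * π))
      (𝓝 (ρ * π * GLimit ρ r)) := by
  rw [GLimit]
  split_ifs with hrc
  · rw [mul_GInf hρ.1.ne']
    have hcont := (hasDerivAt_primG ρ (isLevelPoint_uStar hρ hrc).1).continuousAt
    exact (continuous_im.tendsto _).comp (hcont.tendsto.comp (tendsto_levelPoint_uStar hρ hrc))
  · obtain ⟨x, hx, hlim⟩ := exists_tendsto_levelPoint_mul_pi hρ hr (not_lt.1 hrc)
    simpa using tendsto_im_primG_of_tendsto_ofReal hρ hr nhdsWithin_le_nhds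
      (Ioo_mem_nhdsLT (mul_pos hρ.1 Real.pi_pos)) hx hlim

end Primitives

section Labels

variable {ρ r x δ : ℝ} {N p j : ℕ} {u : ℂ}

/-- The system of `N` sites and `p` particles has density `ρ` and is neither empty nor full. -/
structure HasDensity (ρ : ℝ) (N p : ℕ) : Prop where
  pos : 0 < p
  lt : p < N
  eq_mul : (p : ℝ) = ρ * N

/-- `u` lies on the level curve of radius `r` and carries the label `x`. The points `±1`, where
`logLevel` takes a junk value, are excluded. -/
structure IsLabelPoint (ρ r : ℝ) (N p : ℕ) (x : ℝ) (u : ℂ) : Prop where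
  ne_one : u ≠ 1
  ne_neg_one : u ≠ -1
  logLevel_re_eq : (logLevel ρ u).re = ρ * Real.log r
  labelFun_eq : labelFun N p u = x

lemma HasDensity.natCast_pos (h : HasDensity ρ N p) : (0 : ℝ) < N :=
  Nat.cast_pos.2 (h.pos.trans h.lt)

lemma HasDensity.mem_Ioo (h : HasDensity ρ N p) : ρ ∈ Ioo (0 : ℝ) 1 := by
  have hN := h.natCast_pos
  rw [eq_div_of_mul_eq hN.ne' h.eq_mul.symm]
  exact ⟨div_pos (Nat.cast_pos.2 h.pos) hN, (div_lt_one hN).2 (Nat.cast_lt.2 h.lt)⟩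

lemma mem_labelInterval_iff (hpN : p < N) (hj0 : 0 < j) (hjp : j ≤ p) :
    x ∈ labelInterval N p j ↔ x ∈ Ioc (-(p : ℝ) + 2 * ((j : ℝ) - 1)) (-(p : ℝ) + 2 * j) := by
  have hj0' : (1 : ℝ) ≤ j := Nat.one_le_cast.2 hj0
  have hjp' : (j : ℝ) ≤ p := Nat.cast_le.2 hjp
  have hpN' : (p : ℝ) < N := Nat.cast_lt.2 hpN
  constructor
  · rintro ⟨hx, k, hk⟩
    have hk_gt : (-1 : ℝ) < k := by
      by_contra! h
      nlinarith [hx.2, hk.1]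
    have hk_lt : (k : ℝ) < 1 := by
      by_contra! h
      nlinarith [hx.1, hk.2]
    have hk_gt' : -1 < k := by exact_mod_cast hk_gt
    have hk_lt' : k < 1 := by exact_mod_cast hk_lt
    obtain rfl : k = 0 := by omega
    simpa using hk
  · exact fun hx ↦ ⟨⟨by linarith [hx.1], by linarith [hx.2]⟩, 0, by simpa using hx⟩

lemma labelFun_nonneg (hpN : p ≤ N) (hu : 0 ≤ u.im) : 0 ≤ labelFun N p u := by
  have hpN' : 0 ≤ (N : ℝ) - p := sub_nonneg.2 (Nat.cast_le.2 hpN)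
  have hsub : 0 ≤ arg (u - 1) := arg_nonneg_iff.2 (by simpa using hu)
  have hadd : 0 ≤ arg (u + 1) := arg_nonneg_iff.2 (by simpa using hu)
  unfold labelFun
  positivity

lemma labelFun_conj (hu : u.im ≠ 0) : labelFun N p (conj u) = -labelFun N p u := by
  have harg (c : ℝ) : arg (conj u + c) = -arg (u + c) := by
    rw [← conj_ofReal c, ← map_add, conj_ofReal, arg_conj, if_neg]
    exact fun h ↦ hu (by simpa using (arg_eq_pi_iff.1 h).2)
  have hsub := harg (-1)
  have hadd := harg 1
  simp only [ofReal_neg, ofReal_one, ← sub_eq_add_neg] at hsub hadd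
  rw [labelFun, labelFun, hsub, hadd]
  ring

lemma labelFun_pos (hpN : p < N) (hu : 0 < u.im) : 0 < labelFun N p u := by
  have hpN' : 0 < (N : ℝ) - p := sub_pos.2 (Nat.cast_lt.2 hpN)
  have hsub : 0 ≤ arg (u - 1) := arg_nonneg_iff.2 (by simpa using hu.le)
  have hadd : 0 < arg (u + 1) := add_comm 1 u ▸ arg_one_add_pos hu
  unfold labelFun
  positivity

lemma labelFun_neg (hpN : p < N) (hu : u.im < 0) : labelFun N p u < 0 := by
  have hpos := labelFun_pos (p := p) hpN (u := conj u) (by simpa using hu)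
  rwa [labelFun_conj hu.ne, neg_pos] at hpos

lemma le_labelFun_of_re_lt_one (hpN : p ≤ N) (him : u.im = 0) (hre : u.re < 1) :
    p ≤ labelFun N p u := by
  have hpN' : 0 ≤ (N : ℝ) - p := sub_nonneg.2 (Nat.cast_le.2 hpN)
  have hsub : arg (u - 1) = π := arg_eq_pi_iff.2 ⟨by simpa using hre, by simpa using him⟩
  have hadd : 0 ≤ arg (u + 1) := arg_nonneg_iff.2 (by simpa using him.ge)
  rw [labelFun, hsub, div_mul_cancel₀ _ Real.pi_ne_zero]
  exact le_add_of_nonneg_right (by positivity)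

lemma labelFun_of_one_le (hx : 1 ≤ x) : labelFun N p x = 0 := by
  have hsub : arg ((x : ℂ) - 1) = 0 := by
    rw [← ofReal_one, ← ofReal_sub]
    exact arg_ofReal_of_nonneg (by linarith)
  have hadd : arg ((x : ℂ) + 1) = 0 := add_comm 1 (x : ℂ) ▸ arg_one_add_ofReal (by linarith)
  rw [labelFun, hsub, hadd, mul_zero, mul_zero, add_zero]

lemma im_pos_of_labelFun_mem_Ioo (hpN : p < N) (hu : labelFun N p u ∈ Ioo 0 (p : ℝ)) :
    0 < u.im := by
  by_contra! him
  obtain hneg | hzero := him.lt_or_eq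
  · exact (labelFun_neg hpN hneg).not_gt hu.1
  · have hre : 1 ≤ u.re := by
      by_contra! hre
      exact hu.2.not_ge (le_labelFun_of_re_lt_one hpN.le hzero hre)
    have hreal : u = (u.re : ℂ) := Complex.ext rfl hzero
    exact hu.1.ne' (hreal ▸ labelFun_of_one_le hre)

lemma im_neg_of_labelFun_neg (hpN : p ≤ N) (hu : labelFun N p u < 0) : u.im < 0 := by
  by_contra! him
  exact hu.not_ge (labelFun_nonneg hpN him)

lemma im_eq_zero_of_labelFun_eq_zero (hpN : p < N) (hu : labelFun N p u = 0) : u.im = 0 := by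
  obtain hneg | hzero | hpos := lt_trichotomy u.im 0
  · exact absurd hu (labelFun_neg hpN hneg).ne
  · exact hzero
  · exact absurd hu (labelFun_pos hpN hpos).ne'

lemma HasDensity.labelFun_of_im_pos (h : HasDensity ρ N p) (hu : 0 < u.im) :
    labelFun N p u = N / π * ((logLevel ρ u).im + ρ * π) := by
  have harg := arg_neg_eq_arg_sub_pi_of_im_pos (x := u - 1) (by simpa using hu)
  rw [neg_sub, eq_sub_iff_add_eq] at harg
  rw [labelFun, logLevel_im, ← harg, h.eq_mul, add_comm u]
  ring

lemma HasDensity.pow_mul_pow_eq_exp (h : HasDensity ρ N p) (hsub : u ≠ 1) (hadd : u ≠ -1) :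
    (1 - u) ^ p * (1 + u) ^ (N - p)
      = exp ((N * (logLevel ρ u).re : ℝ) + (π * (labelFun N p u + p) : ℝ) * I) := by
  have hexp_sub : 1 - u = exp (log (u - 1) + π * I) := by
    rw [exp_add, exp_log (sub_ne_zero.2 hsub), exp_pi_mul_I]
    ring
  have hexp_add : 1 + u = exp (log (u + 1)) := by
    rw [exp_log (by rwa [← sub_neg_eq_add, sub_ne_zero]), add_comm]
  have hre : p * Real.log ‖u - 1‖ + (N - p) * Real.log ‖u + 1‖ = N * (logLevel ρ u).re := by
    rw [logLevel_re, norm_sub_rev, add_comm u, h.eq_mul]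
    ring
  have him : p * (arg (u - 1) + π) + (N - p) * arg (u + 1) = π * (labelFun N p u + p) := by
    rw [labelFun]
    field_simp
    ring
  rw [hexp_sub, hexp_add, ← exp_nat_mul, ← exp_nat_mul, ← exp_add, ← hre, ← him,
    Nat.cast_sub h.lt.le, log, log]
  congr 1
  push_cast
  ring

lemma HasDensity.isBetheRoot_iff (h : HasDensity ρ N p) (hr : 0 < r) (hsub : u ≠ 1)
    (hadd : u ≠ -1) : IsBetheRoot N p (r ^ p * exp (δ * I)) u ↔
      ∃ k : ℤ, IsLabelPoint ρ r N p (2 * k - p + δ / π) u := by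
  have hrhs : (r : ℂ) ^ p * exp (δ * I) = exp ((p * Real.log r : ℝ) + δ * I) := by
    rw [exp_add, ofReal_mul, ofReal_natCast, exp_nat_mul, ← ofReal_exp, Real.exp_log hr]
  rw [IsBetheRoot, h.pow_mul_pow_eq_exp hsub hadd, hrhs, exp_eq_exp_iff_exists_int]
  refine exists_congr fun k ↦ ?_
  have hre : N * (logLevel ρ u).re = p * Real.log r ↔ (logLevel ρ u).re = ρ * Real.log r := by
    rw [h.eq_mul, mul_comm ρ, mul_assoc, mul_right_inj' h.natCast_pos.ne']
  have him : π * (labelFun N p u + p) = δ + k * (2 * π) ↔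
      labelFun N p u = 2 * k - p + δ / π := by
    field_simp
    constructor <;> intro hlabel <;> linarith
  have hlabel : IsLabelPoint ρ r N p (2 * k - p + δ / π) u ↔
      (logLevel ρ u).re = ρ * Real.log r ∧ labelFun N p u = 2 * k - p + δ / π :=
    ⟨fun hu ↦ ⟨hu.logLevel_re_eq, hu.labelFun_eq⟩, fun hu ↦ ⟨hsub, hadd, hu.1, hu.2⟩⟩
  rw [hlabel, ← hre, ← him, Complex.ext_iff]
  simp

lemma IsBetheRoot.ne_one {C : ℂ} (h : IsBetheRoot N p C u) (hp : 0 < p) (hC : C ≠ 0) : u ≠ 1 := by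
  rintro rfl
  rw [IsBetheRoot, sub_self, zero_pow hp.ne', zero_mul] at h
  exact hC h.symm

lemma IsBetheRoot.ne_neg_one {C : ℂ} (h : IsBetheRoot N p C u) (hpN : p < N) (hC : C ≠ 0) :
    u ≠ -1 := by
  rintro rfl
  rw [IsBetheRoot, add_neg_cancel, zero_pow (Nat.sub_ne_zero_of_lt hpN), mul_zero] at h
  exact hC h.symm

lemma IsLabelPoint.conj (hu : IsLabelPoint ρ r N p x u) (him : u.im ≠ 0) :
    IsLabelPoint ρ r N p (-x) (conj u) where
  ne_one hone := him (by simpa using congrArg im hone)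
  ne_neg_one hone := him (by simpa using congrArg im hone)
  logLevel_re_eq := by
    have hsub : 1 - conj u = conj (1 - u) := by rw [map_sub, map_one]
    have hadd : 1 + conj u = conj (1 + u) := by rw [map_add, map_one]
    rw [logLevel_re, hsub, hadd, norm_conj, norm_conj, ← logLevel_re, hu.logLevel_re_eq]
  labelFun_eq := by rw [labelFun_conj him, hu.labelFun_eq]

lemma HasDensity.mul_div_mem_Ioo (h : HasDensity ρ N p) (hx : x ∈ Ioo 0 (p : ℝ)) :
    π * x / N ∈ Ioo 0 (ρ * π) := by
  have hN := h.natCast_pos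
  refine ⟨div_pos (mul_pos Real.pi_pos hx.1) hN, ?_⟩
  rw [div_lt_iff₀ hN, mul_right_comm, ← h.eq_mul, mul_comm]
  exact mul_lt_mul_of_pos_right hx.2 Real.pi_pos

lemma HasDensity.isLabelPoint_iff_isLevelPoint (h : HasDensity ρ N p) (hx : x ∈ Ioo 0 (p : ℝ)) :
    IsLabelPoint ρ r N p x u ↔ IsLevelPoint ρ r (π * x / N) u := by
  have hN := h.natCast_pos
  have hlabel (hu : 0 < u.im) :
      labelFun N p u = x ↔ (logLevel ρ u).im = (levelValue ρ r (π * x / N)).im := by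
    rw [h.labelFun_of_im_pos hu, levelValue_im]
    field_simp
    constructor <;> intro heq <;> linarith
  constructor
  · intro hu
    have him := im_pos_of_labelFun_mem_Ioo h.lt (hu.labelFun_eq ▸ hx)
    refine ⟨him, Complex.ext ?_ ((hlabel him).1 hu.labelFun_eq)⟩
    rw [hu.logLevel_re_eq, levelValue_re]
  · rintro ⟨him, hlevel⟩
    refine ⟨(sub_ne_zero.1 (one_sub_ne_zero_of_im_pos him)).symm, fun hone ↦ ?_, ?_,
      (hlabel him).2 (by rw [hlevel])⟩
    · exact one_add_ne_zero_of_im_pos him (by rw [hone, add_neg_cancel])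
    · rw [hlevel, levelValue_re]

end Labels

section LabelPoint

variable {ρ r R x δ : ℝ} {N p j : ℕ} {u v : ℂ}

/-- Parametrization of the level curve of radius `r` in the upper half plane, and of its conjugate
in the lower half plane, by the label. -/
def labelPoint (ρ r : ℝ) (N : ℕ) (x : ℝ) : ℂ :=
  if 0 < x then levelPoint ρ r (π * x / N) else conj (levelPoint ρ r (π * -x / N))

lemma labelPoint_of_pos (hx : 0 < x) : labelPoint ρ r N x = levelPoint ρ r (π * x / N) :=
  if_pos hx

lemma labelPoint_neg (hx : 0 < x) : labelPoint ρ r N (-x) = conj (labelPoint ρ r N x) := by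
  rw [labelPoint, if_neg (neg_nonpos.2 hx.le).not_gt, neg_neg, labelPoint_of_pos hx]

lemma HasDensity.isLevelPoint_labelPoint (h : HasDensity ρ N p) (hr : 0 < r)
    (hx : x ∈ Ioo 0 (p : ℝ)) : IsLevelPoint ρ r (π * x / N) (labelPoint ρ r N x) :=
  labelPoint_of_pos hx.1 ▸ isLevelPoint_levelPoint h.mem_Ioo hr (h.mul_div_mem_Ioo hx)

lemma HasDensity.isLabelPoint_labelPoint (h : HasDensity ρ N p) (hr : 0 < r)
    (hx : x ∈ Ioo (-(p : ℝ)) p) (hx0 : x ≠ 0) :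
    IsLabelPoint ρ r N p x (labelPoint ρ r N x) := by
  have hpos {y : ℝ} (hy : y ∈ Ioo 0 (p : ℝ)) : IsLabelPoint ρ r N p y (labelPoint ρ r N y) :=
    (h.isLabelPoint_iff_isLevelPoint hy).2 (h.isLevelPoint_labelPoint hr hy)
  obtain hlt | hgt := hx0.lt_or_gt
  · have hmem : -x ∈ Ioo 0 (p : ℝ) := ⟨neg_pos.2 hlt, neg_lt.1 hx.1⟩
    have hconj := (hpos hmem).conj (h.isLevelPoint_labelPoint hr hmem).1.ne'
    rwa [← labelPoint_neg hmem.1, neg_neg] at hconj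
  · exact hpos ⟨hgt, hx.2⟩

lemma HasDensity.eq_labelPoint (h : HasDensity ρ N p) (hx : x ∈ Ioo (-(p : ℝ)) p) (hx0 : x ≠ 0)
    (hu : IsLabelPoint ρ r N p x u) : u = labelPoint ρ r N x := by
  have hpos {y : ℝ} {v : ℂ} (hy : y ∈ Ioo 0 (p : ℝ)) (hv : IsLabelPoint ρ r N p y v) :
      v = labelPoint ρ r N y := by
    rw [labelPoint_of_pos hy.1]
    exact (((h.isLabelPoint_iff_isLevelPoint hy).1 hv).eq_levelPoint h.mem_Ioo).symm
  obtain hlt | hgt := hx0.lt_or_gt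
  · have hmem : -x ∈ Ioo 0 (p : ℝ) := ⟨neg_pos.2 hlt, neg_lt.1 hx.1⟩
    have him := im_neg_of_labelFun_neg h.lt.le (hu.labelFun_eq.trans_lt hlt)
    rw [← neg_neg x, labelPoint_neg hmem.1, ← hpos hmem (hu.conj him.ne), conj_conj]
  · exact hpos ⟨hgt, hx.2⟩ hu

lemma HasDensity.isLabelPoint_slitRoot (h : HasDensity ρ N p) (hr : 0 < r) (hj0 : 0 < j)
    (hjp : j ≤ p) (hδ : δ / π ∈ Ioo (-2 : ℝ) 0)
    (hv : IsLabelPoint ρ r N p (2 * j - p + δ / π) v) :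
    IsLabelPoint ρ r N p (2 * j - p + δ / π) (slitRoot N p j (r ^ p * exp (δ * I))) := by
  have hC : (r : ℂ) ^ p * exp (δ * I) ≠ 0 :=
    mul_ne_zero (pow_ne_zero _ (ofReal_ne_zero.2 hr.ne')) (exp_ne_zero _)
  have hroot : IsBetheRoot N p (r ^ p * exp (δ * I)) v :=
    (h.isBetheRoot_iff hr hv.ne_one hv.ne_neg_one).2 ⟨j, by simpa using hv⟩
  have hmem : labelFun N p v ∈ labelInterval N p j := by
    rw [mem_labelInterval_iff h.lt hj0 hjp, hv.labelFun_eq]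
    constructor <;> linarith [hδ.1, hδ.2]
  obtain ⟨hslit, hslitmem⟩ := Classical.epsilon_spec (p := fun u ↦
    IsBetheRoot N p (r ^ p * exp (δ * I)) u ∧ labelFun N p u ∈ labelInterval N p j)
    ⟨v, hroot, hmem⟩
  rw [← slitRoot] at hslit hslitmem
  obtain ⟨k, hk⟩ := (h.isBetheRoot_iff hr (hslit.ne_one h.pos hC)
    (hslit.ne_neg_one h.lt hC)).1 hslit
  rw [mem_labelInterval_iff h.lt hj0 hjp, hk.labelFun_eq] at hslitmem
  have hk_lt : (k : ℝ) < j + 1 := by linarith [hslitmem.2, hδ.1]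
  have hk_gt : (j : ℝ) - 1 < k := by linarith [hslitmem.1, hδ.2]
  have hk_lt' : k < (j : ℤ) + 1 := by exact_mod_cast hk_lt
  have hk_gt' : (j : ℤ) - 1 < k := by exact_mod_cast hk_gt
  obtain rfl : k = j := by omega
  simpa using hk

lemma HasDensity.slitRoot_eq_labelPoint (h : HasDensity ρ N p) (hr : 0 < r) (hj0 : 0 < j)
    (hjp : j ≤ p) (hδ : δ / π ∈ Ioo (-2 : ℝ) 0) (hx0 : 2 * j - p + δ / π ≠ 0) :
    slitRoot N p j (r ^ p * exp (δ * I)) = labelPoint ρ r N (2 * j - p + δ / π) := by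
  have hj0' : (1 : ℝ) ≤ j := Nat.one_le_cast.2 hj0
  have hjp' : (j : ℝ) ≤ p := Nat.cast_le.2 hjp
  have hx : 2 * (j : ℝ) - p + δ / π ∈ Ioo (-(p : ℝ)) p :=
    ⟨by linarith [hδ.1], by linarith [hδ.2]⟩
  exact h.eq_labelPoint hx hx0
    (h.isLabelPoint_slitRoot hr hj0 hjp hδ (h.isLabelPoint_labelPoint hr hx hx0))

lemma HasDensity.labelPoint_mem_levelRegion (h : HasDensity ρ N p) (hr : 0 < r) (hrR : r ≤ R)
    (hR : 1 ≤ R) (hx : x ∈ Ioo (-(p : ℝ)) p) (hx0 : x ≠ 0) :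
    labelPoint ρ r N x ∈ levelRegion ρ R := by
  have hpos {y : ℝ} (hy : y ∈ Ioo 0 (p : ℝ)) : labelPoint ρ r N y ∈ levelRegion ρ R :=
    labelPoint_of_pos hy.1 ▸
      levelPoint_mem_levelRegion h.mem_Ioo hr hrR hR (h.mul_div_mem_Ioo hy)
  obtain hlt | hgt := hx0.lt_or_gt
  · have hmem : -x ∈ Ioo 0 (p : ℝ) := ⟨neg_pos.2 hlt, neg_lt.1 hx.1⟩
    rw [← neg_neg x, labelPoint_neg hmem.1]
    exact conj_mem_levelRegion (hpos hmem)
  · exact hpos ⟨hgt, hx.2⟩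

end LabelPoint

section LabelPointLimits

variable {ρ r R x₀ : ℝ} {N p : ℕ}

lemma tendsto_mul_div_nhdsGT_zero (hN : 0 < N) :
    Tendsto (fun x : ℝ ↦ π * x / N) (𝓝[>] 0) (𝓝[>] 0) := by
  have hcont : ContinuousWithinAt (fun x : ℝ ↦ π * x / N) (Ioi 0) 0 := by fun_prop
  have hmaps : MapsTo (fun x : ℝ ↦ π * x / N) (Ioi 0) (Ioi 0) := fun x hx ↦
    div_pos (mul_pos Real.pi_pos hx) (Nat.cast_pos.2 hN)
  simpa only [mul_zero, zero_div] using hcont.tendsto_nhdsWithin hmaps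

lemma HasDensity.tendsto_mul_div_nhdsLT (h : HasDensity ρ N p) :
    Tendsto (fun x : ℝ ↦ π * x / N) (𝓝[<] p) (𝓝[<] (ρ * π)) := by
  have hN := h.natCast_pos
  have hcont : ContinuousWithinAt (fun x : ℝ ↦ π * x / N) (Iio p) p := by fun_prop
  have hend : π * p / N = ρ * π := by
    rw [h.eq_mul, div_eq_iff hN.ne']
    ring
  have hmaps : MapsTo (fun x : ℝ ↦ π * x / N) (Iio p) (Iio (π * p / N)) := fun x hx ↦
    div_lt_div_of_pos_right (mul_lt_mul_of_pos_left hx Real.pi_pos) hN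
  exact hend ▸ hcont.tendsto_nhdsWithin hmaps

lemma HasDensity.continuousAt_labelPoint (h : HasDensity ρ N p) (hr : 0 < r)
    (hx : x₀ ∈ Ioo (-(p : ℝ)) p) (hx0 : x₀ ≠ 0) : ContinuousAt (labelPoint ρ r N) x₀ := by
  have hpos {y : ℝ} (hy : y ∈ Ioo 0 (p : ℝ)) : ContinuousAt (labelPoint ρ r N) y := by
    have hlevel : ContinuousAt (levelPoint ρ r) (π * y / N) :=
      ((isLevelPoint_levelPoint h.mem_Ioo hr (h.mul_div_mem_Ioo hy)).hasDerivAt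
        h.mem_Ioo).continuousAt
    have hlin : ContinuousAt (fun x : ℝ ↦ π * x / N) y := by fun_prop
    refine (hlevel.comp (f := fun x : ℝ ↦ π * x / N) hlin).congr ?_
    filter_upwards [lt_mem_nhds hy.1] with x hx using (labelPoint_of_pos hx).symm
  obtain hlt | hgt := hx0.lt_or_gt
  · have hneg : ContinuousAt (fun x ↦ conj (labelPoint ρ r N (-x))) x₀ :=
      continuous_conj.continuousAt.comp
        ((hpos ⟨neg_pos.2 hlt, neg_lt.1 hx.1⟩).comp continuous_neg.continuousAt)
    refine hneg.congr ?_
    filter_upwards [gt_mem_nhds hlt] with x hx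
    rw [← labelPoint_neg (neg_pos.2 hx), neg_neg]
  · exact hpos ⟨hgt, hx.2⟩

lemma exists_tendsto_labelPoint_zero (hρ : ρ ∈ Ioo (0 : ℝ) 1) (hr : 0 < r) (hN : 0 < N) :
    ∃ w, Tendsto (labelPoint ρ r N) (𝓝[<] 0) (𝓝 w) := by
  obtain ⟨x, -, hx⟩ := exists_tendsto_levelPoint_zero hρ hr
  have hneg : Tendsto (Neg.neg : ℝ → ℝ) (𝓝[<] 0) (𝓝[>] 0) := by
    simpa only [neg_zero] using tendsto_neg_nhdsLT (a := (0 : ℝ))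
  refine ⟨conj (x : ℂ), Tendsto.congr' ?_ ((continuous_conj.tendsto _).comp
    (hx.comp ((tendsto_mul_div_nhdsGT_zero hN).comp hneg)))⟩
  filter_upwards [self_mem_nhdsWithin] with x hx using (if_neg (not_lt_of_gt hx)).symm

lemma HasDensity.exists_tendsto_labelPoint_natCast (h : HasDensity ρ N p) (hr : 0 < r)
    (hrc : r ≤ rCrit ρ) : ∃ w, Tendsto (labelPoint ρ r N) (𝓝[<] p) (𝓝 w) := by
  obtain ⟨x, -, hx⟩ := exists_tendsto_levelPoint_mul_pi h.mem_Ioo hr hrc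
  refine ⟨x, (hx.comp h.tendsto_mul_div_nhdsLT).congr' ?_⟩
  filter_upwards [Ioo_mem_nhdsLT (Nat.cast_pos.2 h.pos)] with x hx
  exact (labelPoint_of_pos hx.1).symm

lemma HasDensity.exists_tendsto_labelPoint (h : HasDensity ρ N p) (hr : 0 < r)
    (hrc : r ≤ rCrit ρ) (hx : x₀ ∈ Ioc (-(p : ℝ)) p) :
    ∃ w, Tendsto (labelPoint ρ r N) (𝓝[<] x₀) (𝓝 w) := by
  obtain rfl | hx0 := eq_or_ne x₀ 0
  · exact exists_tendsto_labelPoint_zero h.mem_Ioo hr (h.pos.trans h.lt)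
  obtain rfl | hlt := hx.2.eq_or_lt
  · exact h.exists_tendsto_labelPoint_natCast hr hrc
  · exact ⟨_, (h.continuousAt_labelPoint hr ⟨hx.1, hlt⟩ hx0).tendsto.mono_left nhdsWithin_le_nhds⟩

lemma eventually_ne_zero_nhdsLT (x₀ : ℝ) : ∀ᶠ x in 𝓝[<] x₀, x ≠ 0 := by
  obtain hle | hgt := le_or_gt x₀ 0
  · filter_upwards [self_mem_nhdsWithin] with x hx using (lt_of_lt_of_le hx hle).ne
  · filter_upwards [Ioo_mem_nhdsLT hgt] with x hx using hx.1.ne'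

lemma HasDensity.mem_levelRegion_of_tendsto_labelPoint (h : HasDensity ρ N p) (hr : 0 < r)
    (hrR : r ≤ R) (hR : 1 ≤ R) (hx : x₀ ∈ Ioc (-(p : ℝ)) p) {w : ℂ}
    (hw : Tendsto (labelPoint ρ r N) (𝓝[<] x₀) (𝓝 w)) : w ∈ levelRegion ρ R := by
  refine isClosed_levelRegion.mem_of_tendsto hw ?_
  filter_upwards [Ioo_mem_nhdsLT hx.1, eventually_ne_zero_nhdsLT x₀] with x hxmem hx0
  exact h.labelPoint_mem_levelRegion hr hrR hR ⟨hxmem.1, hxmem.2.trans_le hx.2⟩ hx0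

end LabelPointLimits

section MiddleLabel

variable {ρ r R : ℝ} {N p : ℕ} {u : ℂ}

lemma exists_one_lt_logLevel_re_eq (hρ : ρ ∈ Ioo (0 : ℝ) 1) (hr : 0 < r) :
    ∃ x : ℝ, 1 < x ∧ (logLevel ρ x).re = ρ * Real.log r := by
  have hρ1 := sub_pos.2 hρ.2
  have hcont : ContinuousOn (fun x : ℝ ↦ (x - 1) ^ ρ * (1 + x) ^ (1 - ρ)) (Icc 1 (1 + r)) :=
    (((continuous_sub_right 1).rpow_const fun _ ↦ .inr hρ.1.le).mul
      ((continuous_const_add 1).rpow_const fun _ ↦ .inr hρ1.le)).continuousOn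
  have hmem : r ^ ρ ∈ Icc (((1 : ℝ) - 1) ^ ρ * (1 + 1) ^ (1 - ρ))
      ((1 + r - 1) ^ ρ * (1 + (1 + r)) ^ (1 - ρ)) := by
    rw [sub_self, Real.zero_rpow hρ.1.ne', zero_mul, add_sub_cancel_left]
    exact ⟨by positivity, le_mul_of_one_le_right (by positivity)
      (Real.one_le_rpow (by linarith) hρ1.le)⟩
  obtain ⟨x, hx, heq⟩ := intermediate_value_Icc (by linarith) hcont hmem
  have hx1 : 1 < x := by
    refine hx.1.lt_of_ne ?_
    rintro rfl
    simp only [sub_self, Real.zero_rpow hρ.1.ne', zero_mul] at heq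
    exact (Real.rpow_pos_of_pos hr ρ).ne heq
  have hsub : ‖1 - (x : ℂ)‖ = x - 1 := by
    rw [norm_sub_rev, ← ofReal_one, ← ofReal_sub, Complex.norm_of_nonneg (by linarith)]
  have hadd : ‖1 + (x : ℂ)‖ = 1 + x := by
    rw [← ofReal_one, ← ofReal_add, Complex.norm_of_nonneg (by linarith)]
  have hsub_pos : 0 < x - 1 := by linarith
  have hadd_pos : 0 < 1 + x := by linarith
  refine ⟨x, hx1, ?_⟩
  rw [logLevel_re, hsub, hadd, ← Real.log_rpow hsub_pos, ← Real.log_rpow hadd_pos,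
    ← Real.log_mul (by positivity) (by positivity), ← Real.log_rpow hr]
  exact congrArg Real.log heq

lemma exists_isLabelPoint_zero (hρ : ρ ∈ Ioo (0 : ℝ) 1) (hr : 0 < r) (N p : ℕ) :
    ∃ u, IsLabelPoint ρ r N p 0 u := by
  obtain ⟨x, hx, hlevel⟩ := exists_one_lt_logLevel_re_eq hρ hr
  refine ⟨x, ?_, ?_, hlevel, labelFun_of_one_le hx.le⟩
  · exact_mod_cast hx.ne'
  · exact_mod_cast (by linarith : -1 < x).ne'

lemma HasDensity.mem_levelRegion_of_isLabelPoint_zero (h : HasDensity ρ N p) (hr : 0 < r)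
    (hrR : r ≤ R) (hR : 1 ≤ R) (hu : IsLabelPoint ρ r N p 0 u) : u ∈ levelRegion ρ R := by
  have him := im_eq_zero_of_labelFun_eq_zero h.lt hu.labelFun_eq
  have hre : 1 ≤ u.re := by
    by_contra! hre
    have hle := le_labelFun_of_re_lt_one h.lt.le him hre
    rw [hu.labelFun_eq] at hle
    exact hle.not_gt (Nat.cast_pos.2 h.pos)
  refine ⟨norm_le_of_logLevel_re_le h.mem_Ioo hR ?_, ?_⟩
  · rw [hu.logLevel_re_eq]
    exact mul_le_mul_of_nonneg_left (Real.log_le_log hr hrR) h.mem_Ioo.1.le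
  · calc distBound ρ ≤ 1 := min_le_left _ _
      _ ≤ (1 + u).re := by simpa using by linarith
      _ ≤ ‖1 + u‖ := re_le_norm _

end MiddleLabel

section BetheRoots

variable {ρ r R C : ℝ} {N p j : ℕ}

lemma betheRoot_neg_pow (hr : 0 < r) :
    betheRoot N p j (-(r : ℂ) ^ p) = slitRoot N p j (r ^ p * exp ((-π : ℝ) * I)) := by
  have hexp : exp ((-π : ℝ) * I) = -1 := by
    rw [ofReal_neg, neg_mul, exp_neg, exp_pi_mul_I, inv_neg_one]
  have hre : (-(r : ℂ) ^ p).re = -r ^ p := by rw [neg_re, ← ofReal_pow, ofReal_re]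
  rw [betheRoot, if_neg (neg_ne_zero.2 (pow_ne_zero p (ofReal_ne_zero.2 hr.ne'))), if_neg, hexp,
    mul_neg_one]
  rw [hre, not_and, not_lt, neg_nonpos]
  exact fun _ ↦ (pow_pos hr p).le

lemma HasDensity.betheRoot_neg_pow_eq_labelPoint (h : HasDensity ρ N p) (hr : 0 < r)
    (hj0 : 0 < j) (hjp : j ≤ p) (hj : 2 * j ≠ p + 1) :
    betheRoot N p j (-(r : ℂ) ^ p) = labelPoint ρ r N (2 * j - (p + 1 : ℕ)) := by
  have hδ : -π / π = -1 := by rw [neg_div, div_self Real.pi_ne_zero]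
  have hx : 2 * (j : ℝ) - p + -π / π = 2 * j - (p + 1 : ℕ) := by
    rw [hδ]
    push_cast
    ring
  have hx0 : 2 * (j : ℝ) - (p + 1 : ℕ) ≠ 0 := sub_ne_zero.2 (by exact_mod_cast hj)
  rw [betheRoot_neg_pow hr, h.slitRoot_eq_labelPoint hr hj0 hjp (by rw [hδ]; norm_num)
    (hx ▸ hx0), hx]

lemma HasDensity.betheRoot_neg_pow_mem_levelRegion (h : HasDensity ρ N p) (hr : 0 < r)
    (hrR : r ≤ R) (hR : 1 ≤ R) (hj0 : 0 < j) (hjp : j ≤ p) :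
    betheRoot N p j (-(r : ℂ) ^ p) ∈ levelRegion ρ R := by
  obtain hj | hj := eq_or_ne (2 * j) (p + 1)
  · have hδ : -π / π = -1 := by rw [neg_div, div_self Real.pi_ne_zero]
    have hj' : 2 * (j : ℝ) = p + 1 := by exact_mod_cast hj
    have hx : 2 * (j : ℝ) - p + -π / π = 0 := by
      rw [hδ, hj']
      ring
    obtain ⟨v, hv⟩ := exists_isLabelPoint_zero h.mem_Ioo hr N p
    have hslit := h.isLabelPoint_slitRoot hr hj0 hjp (by rw [hδ]; norm_num) (hx ▸ hv)
    rw [hx] at hslit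
    exact betheRoot_neg_pow hr ▸ h.mem_levelRegion_of_isLabelPoint_zero hr hrR hR hslit
  · rw [h.betheRoot_neg_pow_eq_labelPoint hr hj0 hjp hj]
    have hj0' : (1 : ℝ) ≤ j := Nat.one_le_cast.2 hj0
    have hjp' : (j : ℝ) ≤ p := Nat.cast_le.2 hjp
    have hx0 : 2 * (j : ℝ) - (p + 1 : ℕ) ≠ 0 := sub_ne_zero.2 (by exact_mod_cast hj)
    refine h.labelPoint_mem_levelRegion hr hrR hR ?_ hx0
    push_cast
    constructor <;> linarith

lemma HasDensity.betheRoot_pow_of_tendsto (h : HasDensity ρ N p) (hr : 0 < r) (hj0 : 0 < j)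
    (hjp : j ≤ p) {w : ℂ} (hw : Tendsto (labelPoint ρ r N) (𝓝[<] (2 * j - p)) (𝓝 w)) :
    betheRoot N p j ((r : ℂ) ^ p) = w := by
  have hlabel : Tendsto (fun δ : ℝ ↦ 2 * (j : ℝ) - p + δ / π) (𝓝[<] 0) (𝓝[<] (2 * j - p)) := by
    have hcont : ContinuousWithinAt (fun δ : ℝ ↦ 2 * (j : ℝ) - p + δ / π) (Iio 0) 0 := by fun_prop
    have hmaps : MapsTo (fun δ : ℝ ↦ 2 * (j : ℝ) - p + δ / π) (Iio 0) (Iio (2 * j - p)) :=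
      fun δ hδ ↦ add_lt_of_neg_right _ (div_neg_of_neg_of_pos hδ Real.pi_pos)
    simpa only [zero_div, add_zero] using hcont.tendsto_nhdsWithin hmaps
  have hslit : Tendsto (fun δ : ℝ ↦ slitRoot N p j (r ^ p * exp (δ * I))) (𝓝[<] 0) (𝓝 w) := by
    refine (hw.comp hlabel).congr' ?_
    filter_upwards [hlabel.eventually (eventually_ne_zero_nhdsLT _),
      Ioo_mem_nhdsLT (neg_lt_zero.2 Real.two_pi_pos)] with δ hx0 hδ
    refine (h.slitRoot_eq_labelPoint hr hj0 hjp ⟨?_, ?_⟩ hx0).symm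
    · rw [lt_div_iff₀ Real.pi_pos, neg_mul]
      exact hδ.1
    · exact div_neg_of_neg_of_pos hδ.2 Real.pi_pos
  have hC : ((r : ℂ) ^ p).im = 0 ∧ 0 < ((r : ℂ) ^ p).re := by
    rw [← ofReal_pow]
    exact ⟨ofReal_im _, pow_pos hr p⟩
  rw [betheRoot, if_neg (pow_ne_zero p (ofReal_ne_zero.2 hr.ne')), if_pos hC]
  exact hslit.limUnder_eq

lemma HasDensity.betheRoot_pow_eq_labelPoint (h : HasDensity ρ N p) (hr : 0 < r) (hj0 : 0 < j)
    (hjp : j < p) (hj : 2 * j ≠ p) :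
    betheRoot N p j ((r : ℂ) ^ p) = labelPoint ρ r N (2 * j - p) := by
  have hj0' : (0 : ℝ) < j := Nat.cast_pos.2 hj0
  have hjp' : (j : ℝ) < p := Nat.cast_lt.2 hjp
  have hx0 : 2 * (j : ℝ) - p ≠ 0 := sub_ne_zero.2 (by exact_mod_cast hj)
  exact h.betheRoot_pow_of_tendsto hr hj0 hjp.le
    ((h.continuousAt_labelPoint hr ⟨by linarith, by linarith⟩ hx0).tendsto.mono_left
      nhdsWithin_le_nhds)

lemma HasDensity.betheRoot_pow_mem_levelRegion (h : HasDensity ρ N p) (hr : 0 < r)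
    (hrc : r ≤ rCrit ρ) (hrR : r ≤ R) (hR : 1 ≤ R) (hj0 : 0 < j) (hjp : j ≤ p) :
    betheRoot N p j ((r : ℂ) ^ p) ∈ levelRegion ρ R := by
  have hj0' : (0 : ℝ) < j := Nat.cast_pos.2 hj0
  have hjp' : (j : ℝ) ≤ p := Nat.cast_le.2 hjp
  have hx : 2 * (j : ℝ) - p ∈ Ioc (-(p : ℝ)) p := ⟨by linarith, by linarith⟩
  obtain ⟨w, hw⟩ := h.exists_tendsto_labelPoint hr hrc hx
  rw [h.betheRoot_pow_of_tendsto hr hj0 hjp hw]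
  exact h.mem_levelRegion_of_tendsto_labelPoint hr hrR hR hx hw

lemma HasDensity.exists_betheRoot_eq_labelPoint (h : HasDensity ρ N p) (hr : 0 < r)
    (hrC : r ^ p = |C|) (hC : C ≤ rCrit ρ ^ p) (hrR : r ≤ R) (hR : 1 ≤ R) :
    ∃ q : ℕ, p ≤ q ∧ q ≤ p + 1 ∧
      (∀ j, 0 < j → j < q → 2 * j ≠ q → betheRoot N p j C = labelPoint ρ r N (2 * j - q)) ∧
      ∀ j, 0 < j → j ≤ p → betheRoot N p j C ∈ levelRegion ρ R := by
  obtain hneg | hnonneg := lt_or_ge C 0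
  · have hCr : (C : ℂ) = -(r : ℂ) ^ p := by
      rw [← ofReal_pow, hrC, abs_of_neg hneg, ofReal_neg, neg_neg]
    rw [hCr]
    exact ⟨p + 1, p.le_succ, le_rfl,
      fun j hj0 hjq ↦ h.betheRoot_neg_pow_eq_labelPoint hr hj0 (Nat.lt_succ_iff.1 hjq),
      fun j hj0 ↦ h.betheRoot_neg_pow_mem_levelRegion hr hrR hR hj0⟩
  · rw [abs_of_nonneg hnonneg] at hrC
    have hrc : r ≤ rCrit ρ :=
      le_of_pow_le_pow_left₀ h.pos.ne' (rCrit_pos h.mem_Ioo).le (hrC.trans_le hC)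
    rw [← hrC, ofReal_pow]
    exact ⟨p, le_rfl, p.le_succ, fun j ↦ h.betheRoot_pow_eq_labelPoint hr,
      fun j ↦ h.betheRoot_pow_mem_levelRegion hr hrc hrR hR⟩

end BetheRoots

section Sums

variable {ρ r R C : ℝ} {N p : ℕ}

lemma hasDensity_of_eq_mul (hρ : ρ ∈ Ioo (0 : ℝ) 1) (hN : 0 < N) (hp : (p : ℝ) = ρ * N) :
    HasDensity ρ N p := by
  have hN' : (0 : ℝ) < N := Nat.cast_pos.2 hN
  refine ⟨Nat.cast_pos.1 (hp ▸ mul_pos hρ.1 hN'), ?_, hp⟩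
  exact Nat.cast_lt.1 (hp ▸ mul_lt_of_lt_one_left hN' hρ.2)

lemma HasDensity.hasDerivAt_im_labelPoint (h : HasDensity ρ N p) (hr : 0 < r) {A f : ℂ → ℂ}
    (hA : ∀ u, 0 < u.im → HasDerivAt A (f u * logLevelDeriv ρ u) u) {x : ℝ}
    (hx : x ∈ Ioo 0 (p : ℝ)) :
    HasDerivAt (fun y ↦ N / π * (A (levelPoint ρ r (π * y / N))).im)
      (f (labelPoint ρ r N x)).re x := by
  have hN := h.natCast_pos
  have hlin : HasDerivAt (fun y : ℝ ↦ π * y / N) (π / N) x := by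
    simpa only [mul_one, id] using ((hasDerivAt_id x).const_mul π).div_const (N : ℝ)
  have him := hasDerivAt_im_comp_levelPoint h.mem_Ioo hr (h.mul_div_mem_Ioo hx) hA
  refine ((him.comp x hlin).const_mul (N / π)).congr_deriv ?_
  rw [labelPoint_of_pos hx.1]
  field_simp

lemma HasDensity.antitoneOn_re_labelPoint (h : HasDensity ρ N p) {f : ℂ → ℂ}
    (hf : AntitoneOn (fun ψ ↦ (f (levelPoint ρ r ψ)).re) (Ioo 0 (ρ * π))) :
    AntitoneOn (fun x ↦ (f (labelPoint ρ r N x)).re) (Ioo 0 (p : ℝ)) := by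
  intro x hx y hy hxy
  simp only [labelPoint_of_pos hx.1, labelPoint_of_pos hy.1]
  exact hf (h.mul_div_mem_Ioo hx) (h.mul_div_mem_Ioo hy) (by gcongr)

lemma HasDensity.norm_sum_betheRoot_sub_le (h : HasDensity ρ N p) (hr : 0 < r)
    (hrC : r ^ p = |C|) (hC : C ≤ rCrit ρ ^ p) (hrR : r ≤ R) (hR : 1 ≤ R)
    {f A : ℂ → ℂ} {M a b : ℝ}
    (hA : ∀ u, 0 < u.im → HasDerivAt A (f u * logLevelDeriv ρ u) u)
    (hanti : AntitoneOn (fun ψ ↦ (f (levelPoint ρ r ψ)).re) (Ioo 0 (ρ * π)))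
    (hconj : ∀ u, 0 < u.im → f (conj u) = conj (f u))
    (hM : ∀ u ∈ levelRegion ρ R, ‖f u‖ ≤ M)
    (ha : Tendsto (fun ψ ↦ (A (levelPoint ρ r ψ)).im) (𝓝[>] 0) (𝓝 a))
    (hb : Tendsto (fun ψ ↦ (A (levelPoint ρ r ψ)).im) (𝓝[<] (ρ * π)) (𝓝 b)) :
    ‖∑ j ∈ Finset.Icc 1 p, f (betheRoot N p j C) - ((N / π * (b - a) : ℝ) : ℂ)‖ ≤ 12 * M := by
  obtain ⟨q, hpq, hqp, hroot, hmem⟩ := h.exists_betheRoot_eq_labelPoint hr hrC hC hrR hR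
  rw [mul_sub]
  refine norm_sum_sub_le_of_conj_symm h.pos hpq hqp (φ := fun x ↦ f (labelPoint ρ r N x))
    (fun x hx ↦ ?_) (fun j hj0 hjq hj ↦ congrArg f (hroot j hj0 hjq hj))
    (fun j hj0 hjp ↦ hM _ (hmem j hj0 hjp)) (h.antitoneOn_re_labelPoint hanti) (fun x hx ↦ ?_)
    (fun x ↦ h.hasDerivAt_im_labelPoint hr hA)
    ((ha.comp (tendsto_mul_div_nhdsGT_zero (h.pos.trans h.lt))).const_mul _)
    ((hb.comp h.tendsto_mul_div_nhdsLT).const_mul _)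
  · simp only [labelPoint_neg hx.1]
    exact hconj _ (h.isLevelPoint_labelPoint hr hx).1
  · have hx' : x ∈ Ioo (-(p : ℝ)) p := ⟨by linarith [hx.1, hx.2], hx.2⟩
    exact (abs_re_le_norm _).trans
      (hM _ (h.labelPoint_mem_levelRegion hr hrR hR hx' hx.1.ne'))

end Sums

section Limits

variable {ρ r R C : ℝ} {N p : ℕ}

lemma HasDensity.norm_GN_sub_le_of_pos (h : HasDensity ρ N p) (hr : 0 < r) (hrC : r ^ p = |C|)
    (hC : C ≤ rCrit ρ ^ p) (hrR : r ≤ R) (hR : 1 ≤ R) :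
    ‖GN N p C - GLimit ρ r‖ ≤ 12 * logBound ρ R / ρ / N := by
  have hρ := h.mem_Ioo
  have hp : (0 : ℝ) < p := Nat.cast_pos.2 h.pos
  have hsum := h.norm_sum_betheRoot_sub_le hr hrC hC hrR hR (f := fun u ↦ log (1 + u))
    (fun u ↦ hasDerivAt_primG ρ) (antitoneOn_re_log_one_add_levelPoint hρ hr)
    (fun u hu ↦ by
      rw [← log_conj _ (slitPlane_arg_ne_pi (one_add_mem_slitPlane hu)), map_add, map_one])
    (fun u ↦ norm_log_one_add_le hρ) (tendsto_im_primG_zero hρ hr) (tendsto_im_primG_mul_pi hρ hr)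
  have hmain : N / π * (ρ * π * GLimit ρ r - -(ρ * π * Real.log 2))
      = p * (GLimit ρ r + Real.log 2) := by
    rw [h.eq_mul]
    field_simp
    ring
  rw [hmain] at hsum
  have hGN : GN N p C - GLimit ρ r = (p : ℂ)⁻¹ *
      (∑ j ∈ Finset.Icc 1 p, log (1 + betheRoot N p j C)
        - ((p * (GLimit ρ r + Real.log 2) : ℝ) : ℂ)) := by
    have hpC : (p : ℂ) ≠ 0 := Nat.cast_ne_zero.2 h.pos.ne'
    rw [GN, ← ofReal_ofNat, ← ofReal_log zero_le_two]
    push_cast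
    field_simp
    ring
  rw [hGN, norm_mul, norm_inv, norm_natCast, inv_mul_eq_div, div_div, ← h.eq_mul]
  exact div_le_div_of_nonneg_right hsum hp.le

lemma HasDensity.norm_LambdaN_sub_le_of_pos (h : HasDensity ρ N p) (hr : 0 < r)
    (hrC : r ^ p = |C|) (hC : C ≤ rCrit ρ ^ p) (hrR : r ≤ R) (hR : 1 ≤ R) :
    ‖LambdaN N p C - N * LambdaLimit ρ r‖ ≤ 6 * (2 + R) := by
  have hρ := h.mem_Ioo
  have hsum := h.norm_sum_betheRoot_sub_le hr hrC hC hrR hR (f := fun u ↦ u - 1) (M := 2 + R)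
    (fun u ↦ hasDerivAt_primLambda ρ)
    (fun x hx y hy hxy ↦ sub_le_sub_right (antitoneOn_re_levelPoint hρ hr hx hy hxy) 1)
    (fun u _ ↦ by rw [map_sub, map_one])
    (fun u hu ↦ (norm_sub_le u 1).trans (by rw [norm_one]; linarith [hu.1]))
    (tendsto_im_primLambda_zero hρ hr) (tendsto_im_primLambda_mul_pi hρ hr)
  have hmain : N / π * (2 * π * LambdaLimit ρ r - 0) = 2 * (N * LambdaLimit ρ r) := by
    field_simp
    ring
  rw [hmain] at hsum
  have hLambdaN : LambdaN N p C - N * LambdaLimit ρ r = (2 : ℂ)⁻¹ *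
      (∑ j ∈ Finset.Icc 1 p, (betheRoot N p j C - 1)
        - ((2 * (N * LambdaLimit ρ r) : ℝ) : ℂ)) := by
    rw [LambdaN]
    push_cast
    ring
  rw [hLambdaN, norm_mul, norm_inv, norm_ofNat]
  linarith

lemma betheRoot_zero {j : ℕ} (hj : j ∈ Finset.Icc 1 p) : betheRoot N p j 0 = 1 := by
  rw [betheRoot, if_pos rfl, if_pos (Finset.mem_Icc.1 hj).2]

lemma GN_zero (N : ℕ) (hp : 0 < p) : GN N p 0 = 0 := by
  have hsum : ∑ j ∈ Finset.Icc 1 p, log (1 + betheRoot N p j 0) = p * log 2 := by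
    rw [Finset.sum_congr rfl fun j hj ↦ by rw [betheRoot_zero hj, one_add_one_eq_two],
      Finset.sum_const, Nat.card_Icc, Nat.add_sub_cancel, nsmul_eq_mul]
  rw [GN, hsum, one_div, inv_mul_cancel_left₀ (Nat.cast_ne_zero.2 hp.ne'), sub_self]

lemma LambdaN_zero (N p : ℕ) : LambdaN N p 0 = 0 := by
  rw [LambdaN, Finset.sum_eq_zero fun j hj ↦ by rw [betheRoot_zero hj, sub_self], mul_zero]

lemma GLimit_zero (hρ : ρ ∈ Ioo (0 : ℝ) 1) : GLimit ρ 0 = 0 := if_neg (rCrit_pos hρ).not_gt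

lemma LambdaLimit_zero (hρ : ρ ∈ Ioo (0 : ℝ) 1) : LambdaLimit ρ 0 = 0 :=
  if_neg (rCrit_pos hρ).not_gt

lemma logBound_nonneg (ρ R : ℝ) : 0 ≤ logBound ρ R := by
  unfold logBound
  positivity

lemma HasDensity.norm_GN_sub_le (h : HasDensity ρ N p) (hr : 0 ≤ r) (hrC : r ^ p = |C|)
    (hC : C ≤ rCrit ρ ^ p) (hrR : r ≤ R) (hR : 1 ≤ R) :
    ‖GN N p C - GLimit ρ r‖ ≤ 12 * logBound ρ R / ρ / N := by
  obtain rfl | hpos := hr.eq_or_lt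
  · have hbound := logBound_nonneg ρ R
    have hρ := h.mem_Ioo.1
    rw [zero_pow h.pos.ne', eq_comm, abs_eq_zero] at hrC
    rw [hrC, ofReal_zero, GN_zero N h.pos, GLimit_zero h.mem_Ioo, ofReal_zero, sub_self, norm_zero]
    positivity
  · exact h.norm_GN_sub_le_of_pos hpos hrC hC hrR hR

lemma HasDensity.norm_LambdaN_sub_le (h : HasDensity ρ N p) (hr : 0 ≤ r) (hrC : r ^ p = |C|)
    (hC : C ≤ rCrit ρ ^ p) (hrR : r ≤ R) (hR : 1 ≤ R) :
    ‖LambdaN N p C - N * LambdaLimit ρ r‖ ≤ 6 * (2 + R) := by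
  obtain rfl | hpos := hr.eq_or_lt
  · rw [zero_pow h.pos.ne', eq_comm, abs_eq_zero] at hrC
    rw [hrC, ofReal_zero, LambdaN_zero, LambdaLimit_zero h.mem_Ioo, ofReal_zero, mul_zero,
      sub_self, norm_zero]
    positivity
  · exact h.norm_LambdaN_sub_le_of_pos hpos hrC hC hrR hR

lemma exists_radius_bound {K : Set ℝ} (hK : IsCompact K) : ∃ R : ℝ, 1 ≤ R ∧
    ∀ (p : ℕ) (C r : ℝ), 0 < p → r ^ p = |C| → (C ∈ K ∨ r ∈ K) → r ≤ R := by
  obtain ⟨R, hR⟩ := hK.isBounded.exists_norm_le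
  refine ⟨max 1 R, le_max_left _ _, fun p C r hp hrC hmem ↦ ?_⟩
  obtain hCK | hrK := hmem
  · by_contra! hlt
    have hpow : r ≤ r ^ p := le_self_pow₀ ((le_max_left _ _).trans hlt.le) hp.ne'
    exact (hlt.trans_le (hpow.trans (hrC.trans_le (hR C hCK)))).not_ge (le_max_right _ _)
  · exact (le_abs_self r).trans ((hR r hrK).trans (le_max_right _ _))

end Limits

end TASEP

end

/-- The density `ρ = p/N` is fixed. The bound `B` depends only on `ρ` and on the compact set `K`;
it is uniform over all system sizes and over all admissible `C` such that `C` itself or the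
focal radius `r = |C|^(1/p)` lies in `K`. -/
theorem proposition4p3 (ρ : ℝ) (hρ0 : 0 < ρ) (hρ1 : ρ < 1) (K : Set ℝ) (hK : IsCompact K) :
    ∃ B : ℝ, ∀ N p : ℕ, 0 < N → (p : ℝ) = ρ * N →
      ∀ C r : ℝ, C ≤ TASEP.rCrit ρ ^ p → r = |C| ^ (1 / (p : ℝ)) → (C ∈ K ∨ r ∈ K) →
        ‖TASEP.GN N p (C : ℂ) - (TASEP.GLimit ρ r : ℂ)‖ ≤ B / N ∧
        ‖TASEP.LambdaN N p (C : ℂ) - (N : ℂ) * (TASEP.LambdaLimit ρ r : ℂ)‖ ≤ B := by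
  obtain ⟨R, hR, hKR⟩ := TASEP.exists_radius_bound hK
  have hG : 0 ≤ 12 * TASEP.logBound ρ R / ρ := by
    have hlog := TASEP.logBound_nonneg ρ R
    positivity
  have hΛ : 0 ≤ 6 * (2 + R) := by positivity
  refine ⟨12 * TASEP.logBound ρ R / ρ + 6 * (2 + R), fun N p hN hp C r hC hr hmem ↦ ?_⟩
  have h := TASEP.hasDensity_of_eq_mul ⟨hρ0, hρ1⟩ hN hp
  have hr0 : 0 ≤ r := hr ▸ Real.rpow_nonneg (abs_nonneg C) _
  have hrC : r ^ p = |C| := by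
    rw [hr, one_div, Real.rpow_inv_natCast_pow (abs_nonneg C) h.pos.ne']
  have hrR : r ≤ R := hKR p C r h.pos hrC hmem
  exact ⟨(h.norm_GN_sub_le hr0 hrC hC hrR hR).trans
      (div_le_div_of_nonneg_right (le_add_of_nonneg_right hΛ) N.cast_nonneg),
    (h.norm_LambdaN_sub_le hr0 hrC hC hrR hR).trans (le_add_of_nonneg_left hG)⟩
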